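/- Let $T$ be the boundary of the standard $3$-simplex with vertices $e_0,e_1,e_2,e_3$, and let $\Phi\colon T\to S^2$ be a homeomorphism (for instance an orientation preserving one). Write $\mathsf e_i=\Phi(e_i)$, and let $\mathsf F_i\colon\Delta^2\to S^2$ be the singular simplex obtained by composing $\Phi$ with the order preserving affine parametrization of the face of $T$ opposite to $e_i$; the image of this face is also denoted $\mathsf F_i$. The fundamental class is $$\mathsf S^2:=[\mathsf F_0-\mathsf F_1+\mathsf F_2-\mathsf F_3]\in H_2(S^2;\mathbb Z).$$ Let $\mathcal U=\{U_0,U_1,U_2,U_3\}$ be an open cover of $S^2$ with $\mathsf F_i\subseteq U_i$ for all $i$ which is good (all nonempty intersections of its members are contractible). Let $G$ be an abelian group. Let $\check C^p(\mathcal U;G)$ be the ordered Čech complex: cochains are families $(\varphi_{i_0\cdots i_p})_{i_0<\cdots<i_p}$ of locally constant functions $\varphi_{i_0\cdots i_p}\colon U_{i_0\cdots i_p}=U_{i_0}\cap\dots\cap U_{i_p}\to G$ (that is, elements of $G$ whenever $U_{i_0\cdots i_p}\neq\emptyset$), with the usual differential $\delta$. Let $E^{p,q}=\prod_{i_0<\cdots<i_p}C^q_{\mathrm{sing}}(U_{i_0\cdots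 i_p};G)$ be the Čech–singular bicomplex with Čech differential $\delta$, singular coboundary $d$ and total differential $D=\delta+(-1)^pd$, and let $$r_*\colon H^2_{\mathrm{sing}}(S^2;G)\to H^2_D(E),\qquad h_*\colon \check H^2(\mathcal U;G)\to H^2_D(E)$$ be induced by restricting singular cochains to the $U_i$, and by regarding locally constant functions as singular $0$-cochains. Let $\varphi\in\check C^2(\mathcal U;G)$ be a cocycle. Then there is exactly one class $c\in H^2_{\mathrm{sing}}(S^2;G)$ with $r_*c=h_*[\varphi]$; this class $c$ is denoted $\mathscr C[\varphi]$ (so $\mathscr C=r_*^{-1}\circ h_*$). Its pairing with the fundamental class is $$\langle\mathscr C[\varphi],\mathsf S^2\rangle=\varphi_{012}(\mathsf e_3)-\varphi_{013}(\mathsf e_2)+\varphi_{023}(\mathsf e_1)-\varphi_{123}(\mathsf e_0)\in G .$$ -/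

import Mathlib

open TopologicalSpace

namespace CechSingular

noncomputable section

/-! ### Cohomology of a composable pair of homomorphisms -/

/-- The group `ker g / im f` for `A --f--> B --g--> C` (used only when `g ∘ f = 0`). -/
abbrev HomologyOf {A B C : Type*} [AddCommGroup A] [AddCommGroup B] [AddCommGroup C]
    (f : A →+ B) (g : B →+ C) : Type _ :=
  g.ker ⧸ f.range.addSubgroupOf g.ker

/-- The class of an element of `ker g`. -/
abbrev HomologyOf.mk {A B C : Type*} [AddCommGroup A] [AddCommGroup B] [AddCommGroup C]
    (f : A →+ B) (g : B →+ C) (x : g.ker) : HomologyOf f g :=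
  QuotientAddGroup.mk x

/-- The homomorphism induced on `ker g / im f` by `b : B →+ B'` which is part of a morphism of
complexes: it maps `ker g` to `ker g'` and `im f` to `im f'`. -/
def HomologyOf.map {A B C A' B' C' : Type*} [AddCommGroup A] [AddCommGroup B] [AddCommGroup C]
    [AddCommGroup A'] [AddCommGroup B'] [AddCommGroup C']
    (f : A →+ B) (g : B →+ C) (f' : A' →+ B') (g' : B' →+ C') (b : B →+ B')
    (hker : ∀ x, g x = 0 → g' (b x) = 0) (him : ∀ a, ∃ a', f' a' = b (f a)) :
    HomologyOf f g →+ HomologyOf f' g' :=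
  QuotientAddGroup.map _ _
    ((b.comp g.ker.subtype).codRestrict g'.ker fun x => hker x x.2)
    (by
      rintro ⟨x, hx⟩ ⟨a, ha⟩
      obtain ⟨a', ha'⟩ := him a
      exact ⟨a', ha'.trans (congrArg b ha)⟩)

/-! ### Singular chains and cochains -/

section Singular

/-- Singular `n`-simplices of `X`: continuous maps from the standard `n`-simplex. -/
abbrev SingularSimplex (n : ℕ) (X : Type*) [TopologicalSpace X] : Type _ :=
  C(stdSimplex ℝ (Fin (n + 1)), X)

/-- The `i`-th face of a singular simplex, opposite to the `i`-th vertex. -/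
def face {n : ℕ} {X : Type*} [TopologicalSpace X] (i : Fin (n + 2))
    (s : SingularSimplex (n + 1) X) : SingularSimplex n X :=
  s.comp ⟨stdSimplex.map i.succAbove, stdSimplex.continuous_map _⟩

/-- Singular chains with integer coefficients. -/
abbrev SingularChain (n : ℕ) (X : Type*) [TopologicalSpace X] : Type _ :=
  SingularSimplex n X →₀ ℤ

/-- Singular cochains with coefficients in `G`: functions on singular simplices. -/
abbrev SingularCochain (n : ℕ) (X : Type*) [TopologicalSpace X] (G : Type*) : Type _ :=
  SingularSimplex n X → G

/-- The singular boundary `∂ s = ∑ i, (-1) ^ i (i-th face of s)`. -/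
def boundary (n : ℕ) (X : Type*) [TopologicalSpace X] :
    SingularChain (n + 1) X →+ SingularChain n X :=
  Finsupp.liftAddHom fun s =>
    zmultiplesHom _ (∑ i : Fin (n + 2), Finsupp.single (face i s) ((-1 : ℤ) ^ (i : ℕ)))

/-- The singular coboundary `(d c)(s) = ∑ i, (-1) ^ i c (i-th face of s)`. -/
def coboundary (n : ℕ) (X : Type*) [TopologicalSpace X] (G : Type*) [AddCommGroup G] :
    SingularCochain n X G →+ SingularCochain (n + 1) X G where
  toFun c s := ∑ i : Fin (n + 2), (-1 : ℤ) ^ (i : ℕ) • c (face i s)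
  map_zero' := by ext s; simp
  map_add' c c' := by ext s; simp [Finset.sum_add_distrib]

/-- The second singular homology group `H₂(X; ℤ)`. -/
abbrev SingularH₂ (X : Type*) [TopologicalSpace X] : Type _ :=
  HomologyOf (boundary 2 X) (boundary 1 X)

/-- The second singular cohomology group `H²(X; G)`. -/
abbrev SingularCoh₂ (X : Type*) [TopologicalSpace X] (G : Type*) [AddCommGroup G] : Type _ :=
  HomologyOf (coboundary 1 X G) (coboundary 2 X G)

/-- Evaluation of a cochain on a chain, `⟨c, ∑ mₛ s⟩ = ∑ mₛ c(s)`. -/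
def eval {n : ℕ} {X : Type*} [TopologicalSpace X] {G : Type*} [AddCommGroup G] :
    SingularCochain n X G →+ SingularChain n X →+ G where
  toFun c := Finsupp.liftAddHom fun s => zmultiplesHom G (c s)
  map_zero' := by ext; simp
  map_add' c c' := by ext; simp

theorem eval_coboundary {n : ℕ} {X : Type*} [TopologicalSpace X] {G : Type*} [AddCommGroup G]
    (c : SingularCochain n X G) (z : SingularChain (n + 1) X) :
    eval (coboundary n X G c) z = eval c (boundary n X z) := by
  have h : eval (coboundary n X G c) = (eval c).comp (boundary n X) := by
    ext s
    simp [eval, coboundary, boundary]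
  exact DFunLike.congr_fun h z

/-- The pairing `H²(X; G) × H₂(X; ℤ) → G` induced by evaluation of cochains on chains. -/
def pairing (X : Type*) [TopologicalSpace X] (G : Type*) [AddCommGroup G] :
    SingularCoh₂ X G →+ SingularH₂ X →+ G :=
  QuotientAddGroup.lift _
    { toFun := fun c => QuotientAddGroup.lift _ ((eval c.1).comp (boundary 1 X).ker.subtype)
        (by
          rintro ⟨z, hz⟩ ⟨w, rfl⟩
          have hc : coboundary 2 X G c.1 = 0 := c.2
          simp [← eval_coboundary, hc])
      map_zero' := by ext; simp
      map_add' := fun c c' => by ext; simp }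
    (by
      rintro ⟨c, hc⟩ ⟨l, rfl⟩
      ext ⟨z, hz⟩
      have hz' : boundary 1 X z = 0 := hz
      simp [eval_coboundary, hz'])

end Singular

/-! ### Ordered Čech complexes -/

section Cech

variable {X : Type*} [TopologicalSpace X] {ι : Type*} [LinearOrder ι]

/-- A good cover: a locally finite open cover all of whose nonempty (finite) intersections are
contractible. -/
structure IsGoodCover (U : ι → Opens X) : Prop where
  covers : ∀ x, ∃ i, x ∈ U i
  locallyFinite : LocallyFinite fun i => (U i : Set X)
  contractible : ∀ A : Finset ι, A.Nonempty → (⋂ i ∈ A, (U i : Set X)).Nonempty →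
    ContractibleSpace (⋂ i ∈ A, (U i : Set X) : Set X)

/-- The oriented `p`-simplices of the index set: strictly increasing maps `{0, …, p} → ι`.
Those whose intersection is empty are harmless: every presheaf used below is trivial on `∅`. -/
abbrev Idx (p : ℕ) (ι : Type*) [LinearOrder ι] : Type _ := Fin (p + 1) ↪o ι

/-- Remove the `k`-th index. -/
def Idx.drop {p : ℕ} (σ : Idx (p + 1) ι) (k : Fin (p + 2)) : Idx p ι :=
  (Fin.succAboveOrderEmb k).trans σ

/-- The intersection `U_σ`. -/
def inter (U : ι → Opens X) {p : ℕ} (σ : Idx p ι) : Opens X :=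
  ⟨⋂ k, (U (σ k) : Set X), isOpen_iInter_of_finite fun k => (U (σ k)).isOpen⟩

theorem mem_inter {U : ι → Opens X} {p : ℕ} {σ : Idx p ι} {x : X} :
    x ∈ inter U σ ↔ ∀ k, x ∈ U (σ k) := by
  change x ∈ ⋂ k, (U (σ k) : Set X) ↔ _
  simp

theorem inter_le_drop (U : ι → Opens X) {p : ℕ} (σ : Idx (p + 1) ι) (k : Fin (p + 2)) :
    inter U σ ≤ inter U (σ.drop k) := fun _ hx =>
  mem_inter.2 fun j => mem_inter.1 hx (k.succAbove j)

/-- Ordered Čech `p`-cochains of the cover `U` with values in `F`. -/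
abbrev CechCochain (F : Opens X → Type*) (U : ι → Opens X) (p : ℕ) : Type _ :=
  ∀ σ : Idx p ι, F (inter U σ)

/-- The Čech differential of a presheaf of abelian groups `F` with restriction maps `res`:
`(δ c)_σ = ∑ k, (-1) ^ k (c_{σ without σ k} restricted to U_σ)`. -/
def cechDiff {F : Opens X → Type*} [∀ V, AddCommGroup (F V)]
    (res : ∀ V W : Opens X, W ≤ V → F V →+ F W) (U : ι → Opens X) (p : ℕ) :
    CechCochain F U p →+ CechCochain F U (p + 1) where
  toFun c σ := ∑ k : Fin (p + 2),
    (-1 : ℤ) ^ (k : ℕ) • res _ _ (inter_le_drop U σ k) (c (σ.drop k))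
  map_zero' := by ext σ; simp
  map_add' c c' := by ext σ; simp [Finset.sum_add_distrib]

/-- The continuous inclusion of an open set in a larger one. -/
def incl {V W : Opens X} (h : W ≤ V) : C(W, V) :=
  ⟨Set.inclusion h, continuous_inclusion h⟩

variable (G : Type*) [AddCommGroup G]

/-- Restriction of locally constant `G`-valued functions. -/
def resConst (V W : Opens X) (h : W ≤ V) : LocallyConstant V G →+ LocallyConstant W G where
  toFun f := f.comap (incl h)
  map_zero' := by ext; simp
  map_add' f g := by ext; simp

/-- Restriction of singular cochains. -/
def resSing (q : ℕ) (V W : Opens X) (h : W ≤ V) :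
    SingularCochain q V G →+ SingularCochain q W G where
  toFun c s := c ((incl h).comp s)
  map_zero' := rfl
  map_add' _ _ := rfl

/-- Ordered Čech cochains with coefficients in `G`. On a nonempty connected `U_σ`, in particular
for good covers, the component at `σ` is just an element of `G`. -/
abbrev CechG (U : ι → Opens X) (p : ℕ) : Type _ :=
  CechCochain (fun V => LocallyConstant V G) U p

/-- The Čech differential with coefficients in `G`. -/
abbrev cechDiffG (U : ι → Opens X) (p : ℕ) : CechG G U p →+ CechG G U (p + 1) :=
  cechDiff (resConst G) U p

/-- The second Čech cohomology group of the cover `U` (ordered complex). -/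
abbrev CechCoh₂ (U : ι → Opens X) : Type _ :=
  HomologyOf (cechDiffG G U 1) (cechDiffG G U 2)

/-! ### The Čech–singular bicomplex -/

/-- The term `E^{p,q} = ∏_σ C^q(U_σ; G)`. -/
abbrev E (U : ι → Opens X) (p q : ℕ) : Type _ :=
  CechCochain (fun V => SingularCochain q V G) U p

/-- The horizontal differential `δ : E^{p,q} → E^{p+1,q}`. -/
abbrev hor (U : ι → Opens X) (p q : ℕ) : E G U p q →+ E G U (p + 1) q :=
  cechDiff (resSing G q) U p

/-- The vertical differential `d : E^{p,q} → E^{p,q+1}`. -/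
def ver (U : ι → Opens X) (p q : ℕ) : E G U p q →+ E G U p (q + 1) where
  toFun c σ := coboundary q _ G (c σ)
  map_zero' := by ext; simp
  map_add' c c' := by ext; simp

/-- Total cochains of degree one. -/
abbrev Tot₁ (U : ι → Opens X) : Type _ := E G U 0 1 × E G U 1 0

/-- Total cochains of degree two. -/
abbrev Tot₂ (U : ι → Opens X) : Type _ := E G U 0 2 × E G U 1 1 × E G U 2 0

/-- Total cochains of degree three. -/
abbrev Tot₃ (U : ι → Opens X) : Type _ := E G U 0 3 × E G U 1 2 × E G U 2 1 × E G U 3 0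

/-- The total differential `D = δ + (-1) ^ p d` from degree one to degree two. -/
def D₁ (U : ι → Opens X) : Tot₁ G U →+ Tot₂ G U :=
  let x₀₁ : Tot₁ G U →+ E G U 0 1 := AddMonoidHom.fst _ _
  let x₁₀ : Tot₁ G U →+ E G U 1 0 := AddMonoidHom.snd _ _
  ((ver G U 0 1).comp x₀₁).prod
    (((hor G U 0 1).comp x₀₁ - (ver G U 1 0).comp x₁₀).prod ((hor G U 1 0).comp x₁₀))

theorem D₁_apply (U : ι → Opens X) (x : E G U 0 1) (y : E G U 1 0) :
    D₁ G U (x, y) = (ver G U 0 1 x, hor G U 0 1 x - ver G U 1 0 y, hor G U 1 0 y) := rfl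

/-- The total differential `D = δ + (-1) ^ p d` from degree two to degree three. -/
def D₂ (U : ι → Opens X) : Tot₂ G U →+ Tot₃ G U :=
  let x₀₂ : Tot₂ G U →+ E G U 0 2 := AddMonoidHom.fst _ _
  let x₁₁ : Tot₂ G U →+ E G U 1 1 := (AddMonoidHom.fst _ _).comp (AddMonoidHom.snd _ _)
  let x₂₀ : Tot₂ G U →+ E G U 2 0 := (AddMonoidHom.snd _ _).comp (AddMonoidHom.snd _ _)
  ((ver G U 0 2).comp x₀₂).prod
    (((hor G U 0 2).comp x₀₂ - (ver G U 1 1).comp x₁₁).prod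
      (((hor G U 1 1).comp x₁₁ + (ver G U 2 0).comp x₂₀).prod ((hor G U 2 0).comp x₂₀)))

theorem D₂_apply (U : ι → Opens X) (x : E G U 0 2) (y : E G U 1 1) (z : E G U 2 0) :
    D₂ G U (x, y, z) = (ver G U 0 2 x, hor G U 0 2 x - ver G U 1 1 y,
      hor G U 1 1 y + ver G U 2 0 z, hor G U 2 0 z) := rfl

/-- The second total cohomology group of the bicomplex. -/
abbrev TotCoh₂ (U : ι → Opens X) : Type _ := HomologyOf (D₁ G U) (D₂ G U)

/-- The co-augmentation `r : C^q(X; G) → E^{0,q}` by restriction. -/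
def coaugSing (U : ι → Opens X) (q : ℕ) : SingularCochain q X G →+ E G U 0 q where
  toFun c _ s := c (ContinuousMap.comp ⟨Subtype.val, continuous_subtype_val⟩ s)
  map_zero' := rfl
  map_add' _ _ := rfl

/-- The co-augmentation `h : Č^p(U; G) → E^{p,0}`: a locally constant function on `U_σ` is
regarded as a function on singular `0`-simplices, i.e. on points. -/
def coaugCech (U : ι → Opens X) (p : ℕ) : CechG G U p →+ E G U p 0 where
  toFun c σ s := c σ (s default)
  map_zero' := by ext; simp
  map_add' _ _ := by ext; simp

variable (U : ι → Opens X)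

theorem ver_coaugSing (q : ℕ) (c : SingularCochain q X G) :
    ver G U 0 q (coaugSing G U q c) = coaugSing G U (q + 1) (coboundary q X G c) := rfl

theorem hor_coaugSing (q : ℕ) (c : SingularCochain q X G) :
    hor G U 0 q (coaugSing G U q c) = 0 := by
  funext σ s
  have h : ∀ k : Fin 2, resSing G q _ _ (inter_le_drop U σ k)
      (coaugSing G U q c (σ.drop k)) s =
        c (ContinuousMap.comp ⟨Subtype.val, continuous_subtype_val⟩ s) := fun k => rfl
  simp [cechDiff, Fin.sum_univ_two, h]

theorem ver_coaugCech (p : ℕ) (c : CechG G U p) :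
    ver G U p 0 (coaugCech G U p c) = 0 := by
  funext σ s
  have hconst : ∀ x y, c σ (s x) = c σ (s y) := fun x y =>
    ((c σ).isLocallyConstant.comp_continuous s.continuous).apply_eq_of_preconnectedSpace x y
  have h0 : coaugCech G U p c σ (face (0 : Fin 2) s) =
      coaugCech G U p c σ (face (1 : Fin 2) s) := hconst _ _
  simp [ver, coboundary, Fin.sum_univ_two, h0]

theorem hor_coaugCech (p : ℕ) (c : CechG G U p) :
    hor G U p 0 (coaugCech G U p c) = coaugCech G U (p + 1) (cechDiffG G U p c) := by
  funext σ s
  have key : ∀ f : Fin (p + 2) → LocallyConstant (inter U σ) G,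
      ∀ x, (∑ k, f k) x = ∑ k, f k x :=
    fun f x => map_sum (LocallyConstant.evalAddMonoidHom x) f Finset.univ
  change (∑ k : Fin (p + 2), (-1 : ℤ) ^ (k : ℕ) •
      resSing G 0 _ _ (inter_le_drop U σ k) (coaugCech G U p c (σ.drop k))) s =
    (∑ k : Fin (p + 2), (-1 : ℤ) ^ (k : ℕ) •
      resConst G _ _ (inter_le_drop U σ k) (c (σ.drop k))) (s default)
  rw [key, Finset.sum_apply]
  rfl

/-- The map `r_* : H²(X; G) → H²_D(E)` induced by restriction. -/
def coaugSingCoh₂ : SingularCoh₂ X G →+ TotCoh₂ G U :=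
  HomologyOf.map _ _ _ _
    ((AddMonoidHom.inl (E G U 0 2) (E G U 1 1 × E G U 2 0)).comp (coaugSing G U 2))
    (fun c hc => by
      have h := D₂_apply G U (coaugSing G U 2 c) 0 0
      simp only [ver_coaugSing, hor_coaugSing, hc, map_zero, sub_zero, add_zero] at h
      exact h)
    (fun l => ⟨(coaugSing G U 1 l, 0), by
      have h := D₁_apply G U (coaugSing G U 1 l) 0
      simp only [ver_coaugSing, hor_coaugSing, map_zero, sub_zero] at h
      exact h⟩)

/-- The map `h_* : Ȟ²(U; G) → H²_D(E)` induced by the inclusion of Čech cochains. -/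
def coaugCechCoh₂ : CechCoh₂ G U →+ TotCoh₂ G U :=
  HomologyOf.map _ _ _ _
    ((AddMonoidHom.inr (E G U 0 2) (E G U 1 1 × E G U 2 0)).comp
      ((AddMonoidHom.inr (E G U 1 1) (E G U 2 0)).comp (coaugCech G U 2)))
    (fun c hc => by
      have h := D₂_apply G U 0 0 (coaugCech G U 2 c)
      simp only [ver_coaugCech, hor_coaugCech, hc, map_zero, sub_zero, add_zero] at h
      exact h)
    (fun l => ⟨(0, coaugCech G U 1 l), by
      have h := D₁_apply G U 0 (coaugCech G U 1 l)
      simp only [ver_coaugCech, hor_coaugCech, map_zero, sub_zero] at h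
      exact h⟩)

/-- The comparison map `𝒞 = r_*⁻¹ ∘ h_* : Ȟ²(U; G) → H²(X; G)`. Its value at `a` is meaningful
when there is exactly one class `c` with `r_* c = h_* a`. -/
def cechToSingular (a : CechCoh₂ G U) : SingularCoh₂ X G :=
  Function.invFun (coaugSingCoh₂ G U) (coaugCechCoh₂ G U a)

end Cech

/-! ### The sphere and the boundary of the tetrahedron -/

section Sphere

/-- The unit sphere in Euclidean three-space. -/
abbrev S2 : Type := Metric.sphere (0 : EuclideanSpace ℝ (Fin 3)) 1

/-- The boundary of the standard three-dimensional simplex. -/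
abbrev TetraBoundary : Type := {x : stdSimplex ℝ (Fin 4) // ∃ i, x i = 0}

theorem map_succAbove_apply_self {n : ℕ} (i : Fin (n + 1)) (x : stdSimplex ℝ (Fin n)) :
    stdSimplex.map i.succAbove x i = 0 := by
  rw [stdSimplex.map_coe, FunOnFinite.linearMap_apply_apply]
  refine Finset.sum_eq_zero fun j hj => ?_
  exact absurd (Finset.mem_filter.1 hj).2 (Fin.succAbove_ne i j)

theorem vertex_apply_of_ne {i j : Fin 4} (h : j ≠ i) :
    (stdSimplex.vertex (S := ℝ) i) j = 0 := by
  simp [h]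

/-- The vertex `e i` of the tetrahedron. -/
def tetraVertex (i : Fin 4) : TetraBoundary :=
  ⟨stdSimplex.vertex i, by
    obtain ⟨j, hj⟩ := exists_ne i
    exact ⟨j, vertex_apply_of_ne hj⟩⟩

/-- The face opposite to the vertex `e i`, as a subset of the boundary. -/
def tetraFace (i : Fin 4) : Set TetraBoundary := {x | x.1 i = 0}

/-- The face opposite to `e i`, as a singular simplex: the affine map which preserves the order of
the vertices. -/
def tetraFaceSimplex (i : Fin 4) : SingularSimplex 2 TetraBoundary where
  toFun x := ⟨stdSimplex.map i.succAbove x, i, map_succAbove_apply_self i x⟩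
  continuous_toFun := (stdSimplex.continuous_map _).subtype_mk _

variable (Φ : TetraBoundary ≃ₜ S2)

/-- The image of the vertex `e i` on the sphere. -/
def sphereVertex (i : Fin 4) : S2 := Φ (tetraVertex i)

/-- The image of the `i`-th face on the sphere, as a singular simplex. -/
def sphereFace (i : Fin 4) : SingularSimplex 2 S2 :=
  ContinuousMap.comp ⟨Φ, Φ.continuous⟩ (tetraFaceSimplex i)

/-- The chain `F₀ - F₁ + F₂ - F₃`. -/
def fundamentalChain : SingularChain 2 S2 :=
  Finsupp.single (sphereFace Φ 0) 1 - Finsupp.single (sphereFace Φ 1) 1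
    + Finsupp.single (sphereFace Φ 2) 1 - Finsupp.single (sphereFace Φ 3) 1

theorem face_sphereFace (i i' : Fin 4) (j j' : Fin 3)
    (h : i.succAbove ∘ j.succAbove = i'.succAbove ∘ j'.succAbove) :
    face j (sphereFace Φ i) = face j' (sphereFace Φ i') := by
  ext1 x
  simp only [face, sphereFace, tetraFaceSimplex, ContinuousMap.comp_apply, ContinuousMap.coe_mk]
  congr 2
  rw [stdSimplex.map_comp_apply, stdSimplex.map_comp_apply, h]

theorem boundary_fundamentalChain : boundary 1 S2 (fundamentalChain Φ) = 0 := by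
  have h01 := face_sphereFace Φ 0 1 0 0 (by decide)
  have h02 := face_sphereFace Φ 0 2 1 0 (by decide)
  have h03 := face_sphereFace Φ 0 3 2 0 (by decide)
  have h12 := face_sphereFace Φ 1 2 1 1 (by decide)
  have h13 := face_sphereFace Φ 1 3 2 1 (by decide)
  have h23 := face_sphereFace Φ 2 3 2 2 (by decide)
  have hb : ∀ s : SingularSimplex 2 S2, boundary 1 S2 (Finsupp.single s 1) =
      Finsupp.single (face (0 : Fin 3) s) 1 - Finsupp.single (face (1 : Fin 3) s) 1
        + Finsupp.single (face (2 : Fin 3) s) 1 := by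
    intro s
    simp only [boundary, Finsupp.liftAddHom_apply_single, zmultiplesHom_apply, one_smul]
    refine (Fin.sum_univ_three _).trans ?_
    simp [sub_eq_add_neg]
  simp only [fundamentalChain, map_sub, map_add, hb, h01, h02, h03, h12, h13, h23]
  abel

/-- The fundamental class `[F₀ - F₁ + F₂ - F₃] ∈ H₂(S²; ℤ)`. -/
def fundamentalClass : SingularH₂ S2 :=
  HomologyOf.mk _ _ ⟨fundamentalChain Φ, boundary_fundamentalChain Φ⟩

/-- The increasing triple `(i, j, k)` as an oriented `2`-simplex. -/
def triple (i j k : Fin 4) (hij : i < j) (hjk : j < k) : Idx 2 (Fin 4) :=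
  OrderEmbedding.ofStrictMono ![i, j, k] (by
    intro a b hab
    fin_cases a <;> fin_cases b <;> simp_all
    exact hij.trans hjk)

/-- If `U i` contains the image of the `i`-th face for every `i`, then the vertex opposite to the
`l`-th face lies in `U i ∩ U j ∩ U k` for `i, j, k ≠ l`. -/
theorem sphereVertex_mem {U : Fin 4 → Opens S2} (hU : ∀ i, Φ '' tetraFace i ⊆ U i)
    {i j k : Fin 4} (hij : i < j) (hjk : j < k) (l : Fin 4) (hl : i ≠ l ∧ j ≠ l ∧ k ≠ l) :
    sphereVertex Φ l ∈ inter U (triple i j k hij hjk) := by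
  have h : ∀ m, m ≠ l → sphereVertex Φ l ∈ U m := fun m hm =>
    hU m ⟨tetraVertex l, vertex_apply_of_ne hm, rfl⟩
  refine mem_inter.2 fun a => h _ ?_
  fin_cases a
  · exact hl.1
  · exact hl.2.1
  · exact hl.2.2

/-- The value `φ_{ijk}(e_l)` of a Čech `2`-cochain at the image of the vertex `e_l`, where `l` is
the index different from `i < j < k`. -/
def valueAt {U : Fin 4 → Opens S2} (hU : ∀ i, Φ '' tetraFace i ⊆ U i) {G : Type*}
    [AddCommGroup G] (φ : CechG G U 2) (i j k l : Fin 4) (hij : i < j := by decide)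
    (hjk : j < k := by decide) (hl : i ≠ l ∧ j ≠ l ∧ k ≠ l := by decide) : G :=
  φ (triple i j k hij hjk) ⟨sphereVertex Φ l, sphereVertex_mem Φ hU hij hjk l hl⟩

end Sphere

end

end CechSingular

namespace CechSingular

noncomputable section

/-! The formula is read off a zigzag in the bicomplex. If $rc$ and $h\varphi$ are cohomologous,
there are $x\in E^{0,1}$ and $y\in E^{1,0}$ with $dx=rc$, $\delta x=dy$ and $\delta y=-h\varphi$. As
$F_i\subseteq U_i$, the value $c(F_i)$ is $x_i(\partial F_i)$. In the alternating sum over $i$, the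
edge common to two faces $i<j$ occurs twice with opposite signs, and contributes up to sign
$x_j-x_i=(\delta x)_{ij}$, the difference of $y_{ij}$ at its endpoints. The three terms $y$
collected at a vertex $e_l$ form $\pm(\delta y)_{ijk}(e_l)=\mp\varphi_{ijk}(e_l)$. This is
`pairing_fundamentalClass_of_coaug_eq`; it holds for every $c$ with $r_*c=h_*[\varphi]$.

Existence and uniqueness of $c$ rest on two facts. First, the rows are exact (`exists_hor_eq`,
`exists_coaugSing_eq`): for a fixed singular simplex, the indices $i$ such that $U_i$ contains it
span a full simplex, which is a cone over the smallest of them. So total classes can be moved to the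
column $p=0$, where they are cochains on small simplices, those inside some $U_i$.

Second, small chains suffice (`sub_smallHomotopy_mem`): iterated barycentric subdivision gives a
homotopy $h$ such that $1-\partial h-h\partial$ has small values, while $h$ vanishes on small
chains. Composing cochains with $h$ and with this map extends small cocycles to cocycles and shows
that cocycles vanishing on small simplices are coboundaries. -/

/-! ### Chains generated by a set of basis elements -/

/-- The chains which are combinations of the basis elements in `s`. -/
def chainsOn {α : Type*} (s : Set α) : AddSubgroup (α →₀ ℤ) :=
  AddSubgroup.closure ((fun a => Finsupp.single a 1) '' s)

theorem single_mem_chainsOn {α : Type*} {s : Set α} {a : α} (h : a ∈ s) :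
    Finsupp.single a 1 ∈ chainsOn s :=
  AddSubgroup.subset_closure ⟨a, h, rfl⟩

theorem map_mem_of_mem_chainsOn {α B : Type*} [AddCommGroup B] {s : Set α}
    (f : (α →₀ ℤ) →+ B) (M : AddSubgroup B) (h : ∀ a ∈ s, f (Finsupp.single a 1) ∈ M)
    {c : α →₀ ℤ} (hc : c ∈ chainsOn s) : f c ∈ M := by
  have hle : chainsOn s ≤ M.comap f := by
    rw [chainsOn, AddSubgroup.closure_le]
    rintro _ ⟨a, ha, rfl⟩
    exact h a ha
  exact hle hc

theorem chainsOn_mono {α : Type*} {s t : Set α} (h : s ⊆ t) {c : α →₀ ℤ} (hc : c ∈ chainsOn s) :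
    c ∈ chainsOn t :=
  AddSubgroup.closure_mono (Set.image_mono h) hc

/-- The homomorphism on chains with prescribed values on the basis. -/
def chainLift {α B : Type*} [AddCommGroup B] (f : α → B) : (α →₀ ℤ) →+ B :=
  Finsupp.liftAddHom fun a => zmultiplesHom B (f a)

@[simp]
theorem chainLift_single {α B : Type*} [AddCommGroup B] (f : α → B) (a : α) (n : ℤ) :
    chainLift f (Finsupp.single a n) = n • f a := by
  simp [chainLift]

theorem chainHom_ext {α B : Type*} [AddCommGroup B] {f g : (α →₀ ℤ) →+ B}
    (h : ∀ a, f (Finsupp.single a 1) = g (Finsupp.single a 1)) : f = g := by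
  ext a
  exact h a

theorem single_int_eq_smul {α : Type*} (a : α) (n : ℤ) :
    Finsupp.single a n = n • Finsupp.single a (1 : ℤ) := by
  simp

/-! ### Ordered chains, with augmentation -/

section Ordered

variable {P Q : Type*}

/-- Integral combinations of sequences of `m` points. -/
abbrev OrdChain (P : Type*) (m : ℕ) : Type _ := (Fin m → P) →₀ ℤ

/-- The boundary of ordered chains. -/
def ordBoundary (P : Type*) (m : ℕ) : OrdChain P (m + 1) →+ OrdChain P m :=
  chainLift fun v => ∑ i : Fin (m + 1), (-1 : ℤ) ^ (i : ℕ) • Finsupp.single (v ∘ i.succAbove) 1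

theorem ordBoundary_single {m : ℕ} (v : Fin (m + 1) → P) :
    ordBoundary P m (Finsupp.single v 1) =
      ∑ i : Fin (m + 1), (-1 : ℤ) ^ (i : ℕ) • Finsupp.single (v ∘ i.succAbove) 1 := by
  rw [ordBoundary, chainLift_single, one_smul]

/-- The cone with apex `p`. -/
def cone (p : P) (m : ℕ) : OrdChain P m →+ OrdChain P (m + 1) :=
  chainLift fun v => Finsupp.single (Fin.cons p v) 1

@[simp]
theorem cone_single (p : P) {m : ℕ} (v : Fin m → P) :
    cone p m (Finsupp.single v 1) = Finsupp.single (Fin.cons p v) 1 := by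
  rw [cone, chainLift_single, one_smul]

theorem cons_comp_succAbove_succ (p : P) {m : ℕ} (v : Fin (m + 1) → P) (i : Fin (m + 1)) :
    (Fin.cons p v : Fin (m + 2) → P) ∘ i.succ.succAbove = Fin.cons p (v ∘ i.succAbove) := by
  funext j
  refine Fin.cases ?_ (fun j => ?_) j <;> simp

/-- A chain in `OrdChain P 0` is a multiple of the empty sequence, so the complex is augmented and
the cone formula has no correction term here. -/
theorem ordBoundary_cone_zero (p : P) (c : OrdChain P 0) :
    ordBoundary P 0 (cone p 0 c) = c := by
  have : (ordBoundary P 0).comp (cone p 0) = AddMonoidHom.id _ := by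
    refine chainHom_ext fun v => ?_
    simp only [AddMonoidHom.comp_apply, cone_single, ordBoundary_single]
    simp [Subsingleton.elim _ v]
  exact DFunLike.congr_fun this c

/-- Deleting the apex returns the base; deleting a later vertex commutes with coning, and its sign
is shifted by one place. -/
theorem ordBoundary_cone (p : P) {m : ℕ} (c : OrdChain P (m + 1)) :
    ordBoundary P (m + 1) (cone p (m + 1) c) = c - cone p m (ordBoundary P m c) := by
  have : (ordBoundary P (m + 1)).comp (cone p (m + 1)) =
      AddMonoidHom.id _ - (cone p m).comp (ordBoundary P m) := by
    refine chainHom_ext fun v => ?_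
    simp only [AddMonoidHom.comp_apply, cone_single, ordBoundary_single, AddMonoidHom.sub_apply,
      AddMonoidHom.id_apply, map_sum, map_zsmul]
    rw [Fin.sum_univ_succ, sub_eq_add_neg, ← Finset.sum_neg_distrib]
    congr 1
    · have : (Fin.cons p v : Fin (m + 2) → P) ∘ (0 : Fin (m + 2)).succAbove = v := by
        funext j; simp
      rw [this]; simp
    · refine Finset.sum_congr rfl fun i _ => ?_
      rw [cons_comp_succAbove_succ, Fin.val_succ, pow_succ, mul_neg_one, neg_smul]
  exact DFunLike.congr_fun this c

/-- Every sequence is the cone over its tail, so induction with the cone formula replaces the usual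
cancellation in a double sum. -/
theorem ordBoundary_ordBoundary {m : ℕ} (c : OrdChain P (m + 2)) :
    ordBoundary P m (ordBoundary P (m + 1) c) = 0 := by
  induction m with
  | zero =>
    have : (ordBoundary P 0).comp (ordBoundary P 1) = 0 := by
      refine chainHom_ext fun v => ?_
      rw [← Fin.cons_self_tail v, ← cone_single, AddMonoidHom.comp_apply, ordBoundary_cone,
        map_sub, ordBoundary_cone_zero, sub_self, AddMonoidHom.zero_apply]
    exact DFunLike.congr_fun this c
  | succ m ih =>
    have : (ordBoundary P (m + 1)).comp (ordBoundary P (m + 2)) = 0 := by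
      refine chainHom_ext fun v => ?_
      rw [← Fin.cons_self_tail v, ← cone_single, AddMonoidHom.comp_apply, ordBoundary_cone,
        map_sub, ordBoundary_cone, ih, map_zero, sub_zero, sub_self, AddMonoidHom.zero_apply]
    exact DFunLike.congr_fun this c

/-! ### Subdivision and its homotopy to the identity -/

variable (b : ∀ m : ℕ, (Fin (m + 1) → P) → P)

/-- Subdivision of ordered chains with respect to a choice `b` of barycenters. -/
def subdiv : ∀ m : ℕ, OrdChain P m →+ OrdChain P m
  | 0 => AddMonoidHom.id _
  | m + 1 => chainLift fun v =>
      cone (b m v) m (subdiv m (ordBoundary P m (Finsupp.single v 1)))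

/-- The chain homotopy between the subdivision and the identity. -/
def subdivHomotopy : ∀ m : ℕ, OrdChain P m →+ OrdChain P (m + 1)
  | 0 => 0
  | m + 1 => chainLift fun v =>
      cone (b m v) (m + 1)
        (Finsupp.single v 1 - subdivHomotopy m (ordBoundary P m (Finsupp.single v 1)))

theorem subdiv_succ_single {m : ℕ} (v : Fin (m + 1) → P) :
    subdiv b (m + 1) (Finsupp.single v 1) =
      cone (b m v) m (subdiv b m (ordBoundary P m (Finsupp.single v 1))) := by
  rw [subdiv, chainLift_single, one_smul]

theorem subdivHomotopy_succ_single {m : ℕ} (v : Fin (m + 1) → P) :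
    subdivHomotopy b (m + 1) (Finsupp.single v 1) = cone (b m v) (m + 1)
      (Finsupp.single v 1 - subdivHomotopy b m (ordBoundary P m (Finsupp.single v 1))) := by
  rw [subdivHomotopy, chainLift_single, one_smul]

theorem ordBoundary_subdiv {m : ℕ} (c : OrdChain P (m + 1)) :
    ordBoundary P m (subdiv b (m + 1) c) = subdiv b m (ordBoundary P m c) := by
  induction m with
  | zero =>
    have : (ordBoundary P 0).comp (subdiv b 1) = (subdiv b 0).comp (ordBoundary P 0) := by
      refine chainHom_ext fun v => ?_
      rw [AddMonoidHom.comp_apply, subdiv_succ_single, ordBoundary_cone_zero]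
      rfl
    exact DFunLike.congr_fun this c
  | succ m ih =>
    have : (ordBoundary P (m + 1)).comp (subdiv b (m + 2)) =
        (subdiv b (m + 1)).comp (ordBoundary P (m + 1)) := by
      refine chainHom_ext fun v => ?_
      rw [AddMonoidHom.comp_apply, subdiv_succ_single, ordBoundary_cone, ih,
        ordBoundary_ordBoundary, map_zero, map_zero, sub_zero]
      rfl
    exact DFunLike.congr_fun this c

theorem ordBoundary_subdivHomotopy {m : ℕ} (c : OrdChain P (m + 1)) :
    ordBoundary P (m + 1) (subdivHomotopy b (m + 1) c) =
      c - subdiv b (m + 1) c - subdivHomotopy b m (ordBoundary P m c) := by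
  induction m with
  | zero =>
    have : (ordBoundary P 1).comp (subdivHomotopy b 1) =
        AddMonoidHom.id _ - subdiv b 1 - (subdivHomotopy b 0).comp (ordBoundary P 0) := by
      refine chainHom_ext fun v => ?_
      rw [AddMonoidHom.comp_apply, subdivHomotopy_succ_single, ordBoundary_cone]
      simp only [AddMonoidHom.sub_apply, AddMonoidHom.id_apply, AddMonoidHom.comp_apply,
        subdiv_succ_single, subdivHomotopy, AddMonoidHom.zero_apply, sub_zero]
      rfl
    exact DFunLike.congr_fun this c
  | succ m ih =>
    have : (ordBoundary P (m + 2)).comp (subdivHomotopy b (m + 2)) =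
        AddMonoidHom.id _ - subdiv b (m + 2) -
          (subdivHomotopy b (m + 1)).comp (ordBoundary P (m + 1)) := by
      refine chainHom_ext fun v => ?_
      rw [AddMonoidHom.comp_apply, subdivHomotopy_succ_single, ordBoundary_cone, map_sub, ih,
        ordBoundary_ordBoundary]
      simp only [AddMonoidHom.sub_apply, AddMonoidHom.id_apply, AddMonoidHom.comp_apply,
        subdiv_succ_single, map_zero, sub_zero, sub_sub_cancel]
      abel
    exact DFunLike.congr_fun this c

/-- The iterated subdivision. -/
def subdivIter (m : ℕ) : ℕ → (OrdChain P m →+ OrdChain P m)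
  | 0 => AddMonoidHom.id _
  | r + 1 => (subdiv b m).comp (subdivIter m r)

/-- The chain homotopy between the `r`-fold subdivision and the identity. -/
def subdivIterHomotopy (m r : ℕ) : OrdChain P m →+ OrdChain P (m + 1) :=
  ∑ i ∈ Finset.range r, (subdivHomotopy b m).comp (subdivIter b m i)

theorem subdivIterHomotopy_apply (m r : ℕ) (c : OrdChain P m) :
    subdivIterHomotopy b m r c =
      ∑ i ∈ Finset.range r, subdivHomotopy b m (subdivIter b m i c) := by
  simp [subdivIterHomotopy]

theorem ordBoundary_subdivIter {m : ℕ} (r : ℕ) (c : OrdChain P (m + 1)) :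
    ordBoundary P m (subdivIter b (m + 1) r c) = subdivIter b m r (ordBoundary P m c) := by
  induction r with
  | zero => rfl
  | succ r ih =>
    change ordBoundary P m (subdiv b (m + 1) (subdivIter b (m + 1) r c)) = _
    rw [ordBoundary_subdiv, ih]
    rfl

/-- The single-step identities for $S^ic$ telescope, because subdivision $S$ commutes with the
boundary. -/
theorem ordBoundary_subdivIterHomotopy {m : ℕ} (r : ℕ) (c : OrdChain P (m + 1)) :
    ordBoundary P (m + 1) (subdivIterHomotopy b (m + 1) r c) =
      c - subdivIter b (m + 1) r c - subdivIterHomotopy b m r (ordBoundary P m c) := by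
  simp only [subdivIterHomotopy_apply, map_sum, ordBoundary_subdivHomotopy,
    ordBoundary_subdivIter]
  rw [Finset.sum_sub_distrib]
  congr 1
  exact Finset.sum_range_sub' (fun i => subdivIter b (m + 1) i c) r

/-! #### Naturality -/

/-- The map on ordered chains induced by a map of points. -/
def ordMap (f : P → Q) (m : ℕ) : OrdChain P m →+ OrdChain Q m :=
  chainLift fun v => Finsupp.single (f ∘ v) 1

@[simp]
theorem ordMap_single (f : P → Q) {m : ℕ} (v : Fin m → P) :
    ordMap f m (Finsupp.single v 1) = Finsupp.single (f ∘ v) 1 := by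
  rw [ordMap, chainLift_single, one_smul]

theorem ordMap_ordBoundary (f : P → Q) {m : ℕ} (c : OrdChain P (m + 1)) :
    ordMap f m (ordBoundary P m c) = ordBoundary Q m (ordMap f (m + 1) c) := by
  have : (ordMap f m).comp (ordBoundary P m) = (ordBoundary Q m).comp (ordMap f (m + 1)) := by
    refine chainHom_ext fun v => ?_
    simp [ordBoundary_single, Function.comp_assoc, -Finsupp.smul_single]
  exact DFunLike.congr_fun this c

theorem ordMap_cone (f : P → Q) (p : P) {m : ℕ} (c : OrdChain P m) :
    ordMap f (m + 1) (cone p m c) = cone (f p) m (ordMap f m c) := by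
  have : (ordMap f (m + 1)).comp (cone p m) = (cone (f p) m).comp (ordMap f m) := by
    refine chainHom_ext fun v => ?_
    simp [Fin.comp_cons]
  exact DFunLike.congr_fun this c

/-- The construction uses only the choice of barycenters. For the affine face inclusions this says
that subdividing a simplex subdivides its faces compatibly. -/
theorem ordMap_subdiv {b : ∀ m : ℕ, (Fin (m + 1) → P) → P} {b' : ∀ m : ℕ, (Fin (m + 1) → Q) → Q}
    {f : P → Q} (hf : ∀ m v, f (b m v) = b' m (f ∘ v)) {m : ℕ} (c : OrdChain P m) :
    ordMap f m (subdiv b m c) = subdiv b' m (ordMap f m c) := by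
  induction m with
  | zero => rfl
  | succ m ih =>
    have : (ordMap f (m + 1)).comp (subdiv b (m + 1)) =
        (subdiv b' (m + 1)).comp (ordMap f (m + 1)) := by
      refine chainHom_ext fun v => ?_
      rw [AddMonoidHom.comp_apply, AddMonoidHom.comp_apply, ordMap_single, subdiv_succ_single,
        subdiv_succ_single, ordMap_cone, ih, ordMap_ordBoundary, ordMap_single, hf]
    exact DFunLike.congr_fun this c

theorem ordMap_subdivHomotopy {b : ∀ m : ℕ, (Fin (m + 1) → P) → P}
    {b' : ∀ m : ℕ, (Fin (m + 1) → Q) → Q}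
    {f : P → Q} (hf : ∀ m v, f (b m v) = b' m (f ∘ v)) {m : ℕ} (c : OrdChain P m) :
    ordMap f (m + 1) (subdivHomotopy b m c) = subdivHomotopy b' m (ordMap f m c) := by
  induction m with
  | zero => exact map_zero _
  | succ m ih =>
    have : (ordMap f (m + 2)).comp (subdivHomotopy b (m + 1)) =
        (subdivHomotopy b' (m + 1)).comp (ordMap f (m + 1)) := by
      refine chainHom_ext fun v => ?_
      rw [AddMonoidHom.comp_apply, AddMonoidHom.comp_apply, ordMap_single,
        subdivHomotopy_succ_single, subdivHomotopy_succ_single, ordMap_cone, map_sub, ih,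
        ordMap_ordBoundary, ordMap_single, hf]
    exact DFunLike.congr_fun this c

theorem ordMap_subdivIter {b : ∀ m : ℕ, (Fin (m + 1) → P) → P}
    {b' : ∀ m : ℕ, (Fin (m + 1) → Q) → Q}
    {f : P → Q} (hf : ∀ m v, f (b m v) = b' m (f ∘ v)) {m : ℕ} (r : ℕ) (c : OrdChain P m) :
    ordMap f m (subdivIter b m r c) = subdivIter b' m r (ordMap f m c) := by
  induction r with
  | zero => rfl
  | succ r ih => exact (ordMap_subdiv hf _).trans (congrArg _ ih)

theorem ordMap_subdivIterHomotopy {b : ∀ m : ℕ, (Fin (m + 1) → P) → P}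
    {b' : ∀ m : ℕ, (Fin (m + 1) → Q) → Q}
    {f : P → Q} (hf : ∀ m v, f (b m v) = b' m (f ∘ v)) {m : ℕ} (r : ℕ) (c : OrdChain P m) :
    ordMap f (m + 1) (subdivIterHomotopy b m r c) =
      subdivIterHomotopy b' m r (ordMap f m c) := by
  simp only [subdivIterHomotopy_apply, map_sum, ordMap_subdivHomotopy hf, ordMap_subdivIter hf]

/-! #### Vertices in a set closed under barycenters -/

/-- The ordered simplices with vertices in `K`. -/
def verticesIn (K : Set P) (m : ℕ) : Set (Fin m → P) := {v | ∀ i, v i ∈ K}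

theorem ordBoundary_mem_verticesIn {K : Set P} {m : ℕ} {v : Fin (m + 1) → P}
    (hv : v ∈ verticesIn K (m + 1)) :
    ordBoundary P m (Finsupp.single v 1) ∈ chainsOn (verticesIn K m) := by
  rw [ordBoundary_single]
  exact sum_mem fun i _ => zsmul_mem
    (single_mem_chainsOn (show v ∘ i.succAbove ∈ verticesIn K m from fun j => hv _)) _

theorem cone_mem_verticesIn {K : Set P} {p : P} (hp : p ∈ K) {m : ℕ} {c : OrdChain P m}
    (hc : c ∈ chainsOn (verticesIn K m)) :
    cone p m c ∈ chainsOn (verticesIn K (m + 1)) := by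
  refine map_mem_of_mem_chainsOn _ _ (fun v hv => ?_) hc
  rw [cone_single]
  exact single_mem_chainsOn (show Fin.cons p v ∈ verticesIn K (m + 1) from Fin.cases hp hv)

variable {b}

theorem subdivHomotopy_mem_verticesIn {K : Set P}
    (hK : ∀ m v, v ∈ verticesIn K (m + 1) → b m v ∈ K)
    {m : ℕ} {c : OrdChain P m} (hc : c ∈ chainsOn (verticesIn K m)) :
    subdivHomotopy b m c ∈ chainsOn (verticesIn K (m + 1)) := by
  induction m with
  | zero => exact zero_mem _
  | succ m ih =>
    refine map_mem_of_mem_chainsOn _ _ (fun v hv => ?_) hc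
    rw [subdivHomotopy_succ_single]
    exact cone_mem_verticesIn (hK _ _ hv)
      (sub_mem (single_mem_chainsOn hv) (ih (ordBoundary_mem_verticesIn hv)))

end Ordered

/-! ### Affine simplices in a standard simplex -/

section Affine

variable {k l : ℕ}

/-- The convex combination of the points `v i` with the weights `t i`. -/
def comb {n : ℕ} (v : Fin n → stdSimplex ℝ (Fin k)) (t : stdSimplex ℝ (Fin n)) :
    stdSimplex ℝ (Fin k) :=
  ⟨∑ i, t i • (v i : Fin k → ℝ), (convex_stdSimplex ℝ (Fin k)).sum_mem (fun i _ => t.2.1 i) t.2.2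
    fun i _ => (v i).2⟩

theorem comb_mem_of_convex {n : ℕ} {K : Set (Fin k → ℝ)} (hK : Convex ℝ K)
    {v : Fin n → stdSimplex ℝ (Fin k)} (hv : ∀ i, (v i : Fin k → ℝ) ∈ K)
    (t : stdSimplex ℝ (Fin n)) : (comb v t : Fin k → ℝ) ∈ K :=
  hK.sum_mem (fun i _ => t.2.1 i) t.2.2 fun i _ => hv i

theorem continuous_comb {n : ℕ} (v : Fin n → stdSimplex ℝ (Fin k)) : Continuous (comb v) := by
  refine Continuous.subtype_mk ?_ _
  refine continuous_finsetSum _ fun i _ => ?_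
  have h : Continuous fun t : stdSimplex ℝ (Fin n) => (t : Fin n → ℝ) i :=
    (continuous_apply i).comp continuous_subtype_val
  exact h.smul continuous_const

theorem stdSimplex_map_apply {n m : ℕ} (f : Fin n → Fin m) (t : stdSimplex ℝ (Fin n))
    (j : Fin m) : stdSimplex.map f t j = ∑ i, if f i = j then t i else 0 := by
  rw [stdSimplex.map_coe, FunOnFinite.linearMap_apply_apply, Finset.sum_filter]

theorem stdSimplex_map_coe_eq_sum {n m : ℕ} (f : Fin n → Fin m) (t : stdSimplex ℝ (Fin n)) :
    (stdSimplex.map f t : Fin m → ℝ) =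
      ∑ i, t i • ((stdSimplex.vertex (f i) : stdSimplex ℝ (Fin m)) : Fin m → ℝ) := by
  funext j
  rw [stdSimplex_map_apply, Finset.sum_apply]
  refine Finset.sum_congr rfl fun i _ => ?_
  simp [Pi.single_apply, eq_comm]

theorem comb_vertex_comp {n m : ℕ} (f : Fin n → Fin m) (t : stdSimplex ℝ (Fin n)) :
    comb (fun i => stdSimplex.vertex (f i)) t = stdSimplex.map f t :=
  stdSimplex.ext (stdSimplex_map_coe_eq_sum f t).symm

theorem map_comb {n : ℕ} (f : Fin k → Fin l) (v : Fin n → stdSimplex ℝ (Fin k))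
    (t : stdSimplex ℝ (Fin n)) :
    stdSimplex.map f (comb v t) = comb (stdSimplex.map f ∘ v) t := by
  refine stdSimplex.ext ?_
  change _ = ∑ i, t i • (stdSimplex.map f (v i) : Fin l → ℝ)
  simp only [stdSimplex.map_coe]
  change FunOnFinite.linearMap ℝ ℝ f (∑ i, t i • (v i : Fin k → ℝ)) = _
  rw [map_sum]
  simp only [map_smul]

theorem comb_map {n m : ℕ} (f : Fin n → Fin m) (v : Fin m → stdSimplex ℝ (Fin k))
    (t : stdSimplex ℝ (Fin n)) :
    comb v (stdSimplex.map f t) = comb (v ∘ f) t := by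
  refine stdSimplex.ext ?_
  change ∑ j, stdSimplex.map f t j • (v j : Fin k → ℝ) = ∑ i, t i • (v (f i) : Fin k → ℝ)
  simp only [stdSimplex_map_apply, Finset.sum_smul]
  rw [Finset.sum_comm]
  refine Finset.sum_congr rfl fun i _ => ?_
  simp [ite_smul]

/-- The vertices of the standard simplex. -/
def stdVertices (n : ℕ) : Fin n → stdSimplex ℝ (Fin n) := fun i => stdSimplex.vertex i

theorem comb_stdVertices {n : ℕ} (t : stdSimplex ℝ (Fin n)) : comb (stdVertices n) t = t := by
  have := comb_vertex_comp id t
  rwa [stdSimplex.map_id_apply] at this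

theorem map_comp_stdVertices {n m : ℕ} (f : Fin n → Fin m) :
    stdSimplex.map f ∘ stdVertices n = stdVertices m ∘ f := by
  funext i
  simp [stdVertices]

/-- The barycenter of an affine simplex. -/
def affBary (k m : ℕ) (v : Fin (m + 1) → stdSimplex ℝ (Fin k)) : stdSimplex ℝ (Fin k) :=
  comb v stdSimplex.barycenter

theorem map_affBary (f : Fin k → Fin l) (m : ℕ) (v : Fin (m + 1) → stdSimplex ℝ (Fin k)) :
    stdSimplex.map f (affBary k m v) = affBary l m (stdSimplex.map f ∘ v) :=
  map_comb f v _

theorem affBary_mem_of_convex {K : Set (Fin k → ℝ)} (hK : Convex ℝ K) (m : ℕ)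
    (v : Fin (m + 1) → stdSimplex ℝ (Fin k))
    (hv : v ∈ verticesIn ((↑) ⁻¹' K : Set (stdSimplex ℝ (Fin k))) (m + 1)) :
    affBary k m v ∈ ((↑) ⁻¹' K : Set (stdSimplex ℝ (Fin k))) :=
  comb_mem_of_convex hK hv _

/-- The vector from the barycenter to $v_i$ is the mean of the $m+1$ vectors $v_i-v_j$, one of which
is zero. -/
theorem dist_affBary_le {m : ℕ} (v : Fin (m + 1) → stdSimplex ℝ (Fin k)) {d : ℝ}
    (hv : ∀ i j, dist (v i) (v j) ≤ d) (i : Fin (m + 1)) :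
    dist (v i) (affBary k m v) ≤ m / (m + 1) * d := by
  have hm : (0 : ℝ) < m + 1 := by positivity
  have hb : (affBary k m v : Fin k → ℝ) = (m + 1 : ℝ)⁻¹ • ∑ j, (v j : Fin k → ℝ) := by
    change ∑ j, (stdSimplex.barycenter : stdSimplex ℝ (Fin (m + 1))) j • (v j : Fin k → ℝ) = _
    rw [Finset.smul_sum]
    refine Finset.sum_congr rfl fun j _ => ?_
    congr 1
    refine (stdSimplex.barycenter_apply j).trans ?_
    simp
  have h1 : (v i : Fin k → ℝ) - affBary k m v =
      (m + 1 : ℝ)⁻¹ • ∑ j, ((v i : Fin k → ℝ) - (v j : Fin k → ℝ)) := by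
    rw [hb, Finset.sum_sub_distrib, smul_sub]
    congr 1
    rw [Finset.sum_const, Finset.card_univ, Fintype.card_fin, ← Nat.cast_smul_eq_nsmul ℝ,
      smul_smul]
    push_cast
    rw [inv_mul_cancel₀ hm.ne', one_smul]
  have h2 : ‖∑ j, ((v i : Fin k → ℝ) - (v j : Fin k → ℝ))‖ ≤ m * d := by
    rw [Fin.sum_univ_succAbove _ i, sub_self, zero_add]
    refine (norm_sum_le _ _).trans ?_
    refine (Finset.sum_le_sum fun j _ =>
      show ‖(v i : Fin k → ℝ) - (v (i.succAbove j) : Fin k → ℝ)‖ ≤ d from ?_).trans ?_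
    · exact (dist_eq_norm (v i : Fin k → ℝ) (v (i.succAbove j))).symm.trans_le (hv i _)
    · simp
  rw [Subtype.dist_eq, dist_eq_norm]
  change ‖(v i : Fin k → ℝ) - affBary k m v‖ ≤ _
  rw [h1, norm_smul, Real.norm_of_nonneg (by positivity),
    div_eq_inv_mul, mul_assoc]
  gcongr

/-- The affine simplices whose vertices have mutual distances at most `d`. -/
def meshLE (k m : ℕ) (d : ℝ) : Set (Fin m → stdSimplex ℝ (Fin k)) :=
  {v | ∀ i j, dist (v i) (v j) ≤ d}

theorem ordBoundary_mem_verticesIn_inter_meshLE {K : Set (stdSimplex ℝ (Fin k))} {m : ℕ} {d : ℝ}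
    {v : Fin (m + 1) → stdSimplex ℝ (Fin k)} (hv : v ∈ verticesIn K (m + 1) ∩ meshLE k (m + 1) d) :
    ordBoundary _ m (Finsupp.single v 1) ∈ chainsOn (verticesIn K m ∩ meshLE k m d) := by
  rw [ordBoundary_single]
  refine sum_mem fun i _ => zsmul_mem (single_mem_chainsOn (a := v ∘ i.succAbove) ?_) _
  exact ⟨fun j => hv.1 (i.succAbove j), fun _ _ => hv.2 _ _⟩

/-- A piece of the subdivision is a cone from the barycenter over a piece of the subdivided
boundary. The base is small by induction; its distance to the apex is controlled by keeping all
vertices in a convex set, hence the general $K$. The fixed bound $n$ on the dimension gives one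
contraction factor for all $m$, since $m/(m+1)$ increases. -/
theorem subdiv_mem_verticesIn_inter_meshLE {m n : ℕ} (hmn : m ≤ n + 1) {d : ℝ} (hd : 0 ≤ d)
    {K : Set (Fin k → ℝ)} (hK : Convex ℝ K) {c : OrdChain (stdSimplex ℝ (Fin k)) m}
    (hc : c ∈ chainsOn (verticesIn (Subtype.val ⁻¹' K) m ∩ meshLE k m d)) :
    subdiv (affBary k) m c ∈
      chainsOn (verticesIn (Subtype.val ⁻¹' K) m ∩ meshLE k m (n / (n + 1) * d)) := by
  induction m generalizing K with
  | zero => exact chainsOn_mono (Set.inter_subset_inter_right _ fun v _ i => i.elim0) hc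
  | succ m ih =>
    refine map_mem_of_mem_chainsOn _ _ (fun v hv => ?_) hc
    -- This ball is convex and contains all vertices of `v`, so the induction hypothesis for $K\cap
    -- B$ keeps the subdivided boundary within the required distance of the apex.
    set B : Set (Fin k → ℝ) := Metric.closedBall (affBary k m v : Fin k → ℝ) (n / (n + 1) * d)
    have hvB : v ∈ verticesIn ((↑) ⁻¹' (K ∩ B) : Set (stdSimplex ℝ (Fin k))) (m + 1) := by
      refine fun i => ⟨hv.1 i, (dist_affBary_le v hv.2 i).trans ?_⟩
      have h : (m : ℝ) ≤ n := by exact_mod_cast Nat.le_of_succ_le_succ hmn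
      refine mul_le_mul_of_nonneg_right ?_ hd
      rw [div_le_div_iff₀ (by positivity) (by positivity)]
      nlinarith
    rw [subdiv_succ_single]
    refine map_mem_of_mem_chainsOn _ _ (fun w hw => ?_)
      (ih (by omega) (hK.inter (convex_closedBall _ _))
        (ordBoundary_mem_verticesIn_inter_meshLE ⟨hvB, hv.2⟩))
    rw [cone_single]
    refine single_mem_chainsOn (a := (Fin.cons (affBary k m v) w : Fin (m + 1) → _)) ?_
    refine ⟨Fin.cases (affBary_mem_of_convex hK m v hv.1) fun i => (hw.1 i).1, fun i j => ?_⟩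
    refine Fin.cases ?_ (fun i => ?_) i <;> refine Fin.cases ?_ (fun j => ?_) j
    · rw [dist_self]; positivity
    · rw [dist_comm]; exact (hw.1 j).2
    · exact (hw.1 i).2
    · exact hw.2 i j

theorem dist_stdSimplex_le_one (x y : stdSimplex ℝ (Fin k)) : dist x y ≤ 1 :=
  (Metric.dist_le_diam_of_mem (bounded_stdSimplex _) x.2 y.2).trans diam_stdSimplex_le

theorem subdivIter_mem_meshLE {m n : ℕ} (hmn : m ≤ n + 1)
    (c : OrdChain (stdSimplex ℝ (Fin k)) m) (r : ℕ) :
    subdivIter (affBary k) m r c ∈ chainsOn (meshLE k m ((n / (n + 1)) ^ r)) := by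
  suffices h : subdivIter (affBary k) m r c ∈
      chainsOn (verticesIn (Subtype.val ⁻¹' Set.univ) m ∩ meshLE k m ((n / (n + 1)) ^ r)) from
    chainsOn_mono Set.inter_subset_right h
  induction r with
  | zero =>
    induction c using Finsupp.induction_linear with
    | zero => exact zero_mem _
    | add f g hf hg => exact add_mem hf hg
    | single v a =>
      rw [single_int_eq_smul]
      refine zsmul_mem (single_mem_chainsOn (a := v) ?_) _
      exact ⟨fun _ => Set.mem_univ _, fun i j => by
        simpa using dist_stdSimplex_le_one (v i) (v j)⟩
  | succ r ih =>
    rw [pow_succ']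
    exact subdiv_mem_verticesIn_inter_meshLE hmn (by positivity) convex_univ ih

end Affine

/-! ### Small singular chains -/

section Small

variable {X : Type*} [TopologicalSpace X]

theorem boundary_single {n : ℕ} (s : SingularSimplex (n + 1) X) :
    boundary n X (Finsupp.single s 1) =
      ∑ i : Fin (n + 2), (-1 : ℤ) ^ (i : ℕ) • Finsupp.single (face i s) 1 := by
  simp [boundary]

/-- The affine singular simplex with given vertices in a standard simplex. -/
def affSimplex {k n : ℕ} (v : Fin (n + 1) → stdSimplex ℝ (Fin k)) :
    SingularSimplex n (stdSimplex ℝ (Fin k)) := ⟨comb v, continuous_comb v⟩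

/-- The image of affine chains under a singular simplex. -/
def push {k : ℕ} (s : SingularSimplex k X) (n : ℕ) :
    OrdChain (stdSimplex ℝ (Fin (k + 1))) (n + 1) →+ SingularChain n X :=
  chainLift fun v => Finsupp.single (s.comp (affSimplex v)) 1

@[simp]
theorem push_single {k : ℕ} (s : SingularSimplex k X) {n : ℕ}
    (v : Fin (n + 1) → stdSimplex ℝ (Fin (k + 1))) :
    push s n (Finsupp.single v 1) = Finsupp.single (s.comp (affSimplex v)) 1 := by
  rw [push, chainLift_single, one_smul]

theorem boundary_push {k : ℕ} (s : SingularSimplex k X) {n : ℕ}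
    (c : OrdChain (stdSimplex ℝ (Fin (k + 1))) (n + 2)) :
    boundary n X (push s (n + 1) c) = push s n (ordBoundary _ (n + 1) c) := by
  have : (boundary n X).comp (push s (n + 1)) = (push s n).comp (ordBoundary _ (n + 1)) := by
    refine chainHom_ext fun v => ?_
    simp only [AddMonoidHom.comp_apply, push_single, boundary_single, ordBoundary_single, map_sum,
      map_zsmul]
    refine Finset.sum_congr rfl fun i _ => ?_
    congr 2
    ext t
    exact congrArg s (comb_map i.succAbove v t)
  exact DFunLike.congr_fun this c

theorem push_stdVertices {n : ℕ} (s : SingularSimplex n X) :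
    push s n (Finsupp.single (stdVertices (n + 1)) 1) = Finsupp.single s 1 := by
  rw [push_single]
  congr 1
  ext t
  exact congrArg s (comb_stdVertices t)

theorem push_face {k : ℕ} (s : SingularSimplex (k + 1) X) (i : Fin (k + 2)) {n : ℕ}
    (c : OrdChain (stdSimplex ℝ (Fin (k + 1))) (n + 1)) :
    push (face i s) n c = push s n (ordMap (stdSimplex.map i.succAbove) (n + 1) c) := by
  have : push (face i s) n = (push s n).comp (ordMap (stdSimplex.map i.succAbove) (n + 1)) := by
    refine chainHom_ext fun v => ?_
    simp only [AddMonoidHom.comp_apply, push_single, ordMap_single]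
    congr 1
    ext t
    exact congrArg s (map_comb i.succAbove v t)
  exact DFunLike.congr_fun this c

/-- Every singular simplex is the image of the identity affine simplex, so the identity is inherited
from ordered chains. -/
theorem boundary_boundary {n : ℕ} (c : SingularChain (n + 2) X) :
    boundary n X (boundary (n + 1) X c) = 0 := by
  have : (boundary n X).comp (boundary (n + 1) X) = 0 := by
    refine chainHom_ext fun s => ?_
    rw [AddMonoidHom.comp_apply, ← push_stdVertices s, boundary_push, boundary_push,
      ordBoundary_ordBoundary, map_zero, AddMonoidHom.zero_apply]
  exact DFunLike.congr_fun this c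

/-! ### Simplices subordinate to the cover and the number of subdivisions -/

variable {ι : Type*} (U : ι → Opens X)

/-- The singular simplices whose image lies in a member of `U`. -/
def smallSimplices (n : ℕ) : Set (SingularSimplex n X) := {s | ∃ i, ∀ t, s t ∈ U i}

/-- The affine simplices in a standard simplex whose image under `s` lies in a member of `U`. -/
def smallAffine {k : ℕ} (s : SingularSimplex k X) (m : ℕ) :
    Set (Fin m → stdSimplex ℝ (Fin (k + 1))) :=
  {v | ∃ i, ∀ x : stdSimplex ℝ (Fin (k + 1)),
    (x : Fin (k + 1) → ℝ) ∈ convexHull ℝ (Set.range fun a => (v a : Fin (k + 1) → ℝ)) → s x ∈ U i}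

variable {U}

theorem face_mem_smallSimplices {n : ℕ} {s : SingularSimplex (n + 1) X}
    (hs : s ∈ smallSimplices U (n + 1)) (j : Fin (n + 2)) : face j s ∈ smallSimplices U n :=
  hs.imp fun _ hi _ => hi _

theorem push_mem_smallSimplices {k : ℕ} {s : SingularSimplex k X} {n : ℕ}
    {c : OrdChain (stdSimplex ℝ (Fin (k + 1))) (n + 1)}
    (hc : c ∈ chainsOn (smallAffine U s (n + 1))) : push s n c ∈ chainsOn (smallSimplices U n) := by
  refine map_mem_of_mem_chainsOn _ _ (fun v hv => ?_) hc
  rw [push_single]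
  obtain ⟨i, hi⟩ := hv
  refine single_mem_chainsOn ?_
  exact ⟨i, fun t => hi _ (comb_mem_of_convex (convex_convexHull ℝ _)
    (fun a => subset_convexHull ℝ _ (Set.mem_range_self a)) t)⟩

/-- The homotopy only uses points of the convex hull of the original vertices. This is why smallness
is tested on the whole hull. -/
theorem subdivHomotopy_mem_smallAffine {k : ℕ} {s : SingularSimplex k X} {m : ℕ}
    {c : OrdChain (stdSimplex ℝ (Fin (k + 1))) m} (hc : c ∈ chainsOn (smallAffine U s m)) :
    subdivHomotopy (affBary (k + 1)) m c ∈ chainsOn (smallAffine U s (m + 1)) := by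
  refine map_mem_of_mem_chainsOn _ _ (fun v hv => ?_) hc
  obtain ⟨i, hi⟩ := hv
  set K := convexHull ℝ (Set.range fun a => (v a : Fin (k + 1) → ℝ))
  refine chainsOn_mono (fun w hw => Exists.intro i fun x hx => hi x ?_)
    (subdivHomotopy_mem_verticesIn (K := Subtype.val ⁻¹' K)
      (affBary_mem_of_convex (convex_convexHull ℝ _))
      (single_mem_chainsOn (show v ∈ verticesIn (Subtype.val ⁻¹' K) m from
        fun a => subset_convexHull ℝ _ (Set.mem_range_self a))))
  refine convexHull_min ?_ (convex_convexHull ℝ _) hx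
  rintro _ ⟨a, rfl⟩
  exact hw a

/-- The property that the `r`-fold subdivision and all finer ones are small. -/
def IsFine (U : ι → Opens X) {n : ℕ} (s : SingularSimplex n X) (r : ℕ) : Prop :=
  ∀ i, r ≤ i → ∀ m, m ≤ n → ∀ c : OrdChain (stdSimplex ℝ (Fin (n + 1))) (m + 1),
    subdivIter (affBary (n + 1)) (m + 1) i c ∈ chainsOn (smallAffine U s (m + 1))

/-- A Lebesgue number of the pulled-back cover eventually exceeds the mesh, which decays
geometrically and so stays below it for all later iterates. -/
theorem exists_isFine (hU : ∀ x, ∃ i, x ∈ U i) {n : ℕ} (s : SingularSimplex n X) :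
    ∃ r, IsFine U s r := by
  obtain ⟨δ, hδ, hball⟩ := lebesgue_number_lemma_of_metric (s := (Set.univ : Set (stdSimplex ℝ
    (Fin (n + 1))))) (c := fun i => s ⁻¹' (U i : Set X)) isCompact_univ
    (fun i => (U i).isOpen.preimage s.continuous)
    (fun x _ => Set.mem_iUnion.2 (hU (s x)))
  have hlt : (n : ℝ) / (n + 1) < 1 := by
    rw [div_lt_one (by positivity)]
    linarith
  obtain ⟨r, hr⟩ := exists_pow_lt_of_lt_one hδ hlt
  refine ⟨r, fun i hi m hm c => chainsOn_mono (fun v hv => ?_)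
    (subdivIter_mem_meshLE (n := n) (by omega) c i)⟩
  obtain ⟨j, hj⟩ := hball (v 0) (Set.mem_univ _)
  refine ⟨j, fun x hx => hj ?_⟩
  have hpow : ((n : ℝ) / (n + 1)) ^ i < δ :=
    (pow_le_pow_of_le_one (by positivity) hlt.le hi).trans_lt hr
  have hx' : (x : Fin (n + 1) → ℝ) ∈ Metric.ball (v 0 : Fin (n + 1) → ℝ) δ := by
    refine convexHull_min ?_ (convex_ball _ _) hx
    rintro _ ⟨a, rfl⟩
    exact (hv a 0).trans_lt hpow
  exact hx'

theorem mem_chainsOn_univ {α : Type*} (c : α →₀ ℤ) : c ∈ chainsOn (Set.univ : Set α) := by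
  induction c using Finsupp.induction_linear with
  | zero => exact zero_mem _
  | add f g hf hg => exact add_mem hf hg
  | single v a =>
    rw [single_int_eq_smul]
    exact zsmul_mem (single_mem_chainsOn (Set.mem_univ _)) _

theorem isFine_zero {n : ℕ} {s : SingularSimplex n X} (hs : s ∈ smallSimplices U n) :
    IsFine U s 0 := by
  obtain ⟨i, hi⟩ := hs
  exact fun j _ m _ c => chainsOn_mono (fun v _ => Exists.intro i fun x _ => hi x)
    (mem_chainsOn_univ _)

open Classical in
/-- The number of subdivisions after which `s` is small. -/
def fineness (hU : ∀ x, ∃ i, x ∈ U i) {n : ℕ} (s : SingularSimplex n X) : ℕ :=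
  Nat.find (exists_isFine hU s)

theorem isFine_fineness (hU : ∀ x, ∃ i, x ∈ U i) {n : ℕ} (s : SingularSimplex n X) :
    IsFine U s (fineness hU s) := by
  classical
  exact Nat.find_spec (exists_isFine hU s)

theorem fineness_eq_zero (hU : ∀ x, ∃ i, x ∈ U i) {n : ℕ} {s : SingularSimplex n X}
    (hs : s ∈ smallSimplices U n) : fineness hU s = 0 := by
  classical
  exact (Nat.find_eq_zero _).2 (isFine_zero hs)

/-- The chain homotopy between the identity and a chain map to the small chains. -/
def smallHomotopy (hU : ∀ x, ∃ i, x ∈ U i) (n : ℕ) : SingularChain n X →+ SingularChain (n + 1) X :=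
  chainLift fun s => push s (n + 1) (subdivIterHomotopy (affBary (n + 1)) (n + 1) (fineness hU s)
    (Finsupp.single (stdVertices (n + 1)) 1))

theorem smallHomotopy_single (hU : ∀ x, ∃ i, x ∈ U i) {n : ℕ} (s : SingularSimplex n X) :
    smallHomotopy hU n (Finsupp.single s 1) = push s (n + 1)
      (subdivIterHomotopy (affBary (n + 1)) (n + 1) (fineness hU s)
        (Finsupp.single (stdVertices (n + 1)) 1)) := by
  rw [smallHomotopy, chainLift_single, one_smul]

theorem smallHomotopy_eq_zero (hU : ∀ x, ∃ i, x ∈ U i) {n : ℕ} {c : SingularChain n X}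
    (hc : c ∈ chainsOn (smallSimplices U n)) : smallHomotopy hU n c = 0 := by
  refine AddSubgroup.mem_bot.1 (map_mem_of_mem_chainsOn _ _ (fun s hs => ?_) hc)
  rw [AddSubgroup.mem_bot, smallHomotopy_single, fineness_eq_zero hU hs, subdivIterHomotopy_apply,
    Finset.range_zero, Finset.sum_empty, map_zero]

/-- Only the terms with index between $p$ and $q$ survive, and the hypothesis belonging to the
smaller bound covers them all. -/
theorem sum_range_sub_sum_range_mem {A : Type*} [AddCommGroup A] (M : AddSubgroup A) (f : ℕ → A)
    {p q : ℕ} (hp : ∀ i, p ≤ i → f i ∈ M) (hq : ∀ i, q ≤ i → f i ∈ M) :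
    ∑ i ∈ Finset.range p, f i - ∑ i ∈ Finset.range q, f i ∈ M := by
  rcases le_total p q with h | h
  · rw [← neg_sub, ← Finset.sum_Ico_eq_sub _ h]
    exact neg_mem (sum_mem fun i hi => hp i (Finset.mem_Ico.1 hi).1)
  · rw [← Finset.sum_Ico_eq_sub _ h]
    exact sum_mem fun i hi => hq i (Finset.mem_Ico.1 hi).1

/-- The number of subdivisions depends on the simplex, so the homotopy does not commute with faces.
On $s$ the expression is the subdivided $s$ plus, for each face, the difference of the homotopies of
lengths `fineness hU s` and `fineness hU (face j s)`. That difference involves only iterates past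
one of these numbers, which are already small. -/
theorem sub_smallHomotopy_mem (hU : ∀ x, ∃ i, x ∈ U i) {n : ℕ} (c : SingularChain (n + 1) X) :
    c - boundary (n + 1) X (smallHomotopy hU (n + 1) c) - smallHomotopy hU n (boundary n X c) ∈
      chainsOn (smallSimplices U (n + 1)) := by
  refine map_mem_of_mem_chainsOn (s := Set.univ) (AddMonoidHom.id _ -
    (boundary (n + 1) X).comp (smallHomotopy hU (n + 1)) -
    (smallHomotopy hU n).comp (boundary n X)) _ (fun s _ => ?_) (mem_chainsOn_univ c)
  set ω : OrdChain (stdSimplex ℝ (Fin (n + 2))) (n + 2) :=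
    Finsupp.single (stdVertices (n + 2)) 1 with hω
  set r := fineness hU s
  have h1 : boundary (n + 1) X (smallHomotopy hU (n + 1) (Finsupp.single s 1)) =
      Finsupp.single s 1 - push s (n + 1) (subdivIter (affBary (n + 2)) (n + 2) r ω) -
        ∑ j : Fin (n + 2), (-1 : ℤ) ^ (j : ℕ) • push (face j s) (n + 1)
          (subdivIterHomotopy (affBary (n + 1)) (n + 1) r
            (Finsupp.single (stdVertices (n + 1)) 1)) := by
    rw [smallHomotopy_single, boundary_push, ordBoundary_subdivIterHomotopy, map_sub, map_sub,
      push_stdVertices, ordBoundary_single, map_sum, map_sum]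
    congr 1
    refine Finset.sum_congr rfl fun j _ => ?_
    rw [push_face, ordMap_subdivIterHomotopy (map_affBary _), ordMap_single,
      map_comp_stdVertices, map_zsmul, map_zsmul]
  have h2 : smallHomotopy hU n (boundary n X (Finsupp.single s 1)) =
      ∑ j : Fin (n + 2), (-1 : ℤ) ^ (j : ℕ) • push (face j s) (n + 1)
        (subdivIterHomotopy (affBary (n + 1)) (n + 1) (fineness hU (face j s))
          (Finsupp.single (stdVertices (n + 1)) 1)) := by
    simp only [boundary_single, map_sum, map_zsmul, smallHomotopy_single]
  simp only [AddMonoidHom.sub_apply, AddMonoidHom.id_apply, AddMonoidHom.comp_apply]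
  rw [h1, h2]
  have h3 : ∀ a b c d : SingularChain (n + 1) X, a - (a - b - c) - d = b + (c - d) := by
    intros; abel
  rw [h3, ← Finset.sum_sub_distrib]
  refine add_mem (push_mem_smallSimplices (isFine_fineness hU s r le_rfl _ le_rfl _))
    (sum_mem fun j _ => ?_)
  rw [← smul_sub, subdivIterHomotopy_apply, subdivIterHomotopy_apply, map_sum, map_sum]
  refine zsmul_mem (sum_range_sub_sum_range_mem _ _ (fun i hi => ?_) fun i hi => ?_) _
  -- Iterates past the fineness of $s$: the face is viewed inside $s$, whose fineness also covers
  -- affine simplices of lower dimension.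
  · rw [push_face, ordMap_subdivHomotopy (map_affBary _), ordMap_subdivIter (map_affBary _)]
    exact push_mem_smallSimplices (subdivHomotopy_mem_smallAffine
      (isFine_fineness hU s i hi _ n.le_succ _))
  · exact push_mem_smallSimplices (subdivHomotopy_mem_smallAffine
      (isFine_fineness hU (face j s) i hi _ le_rfl _))

end Small

/-! ### Exactness of the rows of the Čech–singular bicomplex -/

section Rows

variable {X : Type*} [TopologicalSpace X] {ι : Type*} [LinearOrder ι]

/-- Prepend a smaller index. -/
def Idx.cons {p : ℕ} (i : ι) (σ : Idx p ι) (h : i < σ 0) : Idx (p + 1) ι :=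
  OrderEmbedding.ofStrictMono (Fin.cons i σ : Fin (p + 2) → ι) <| Fin.strictMono_iff_lt_succ.2 <| by
    refine Fin.cases ?_ fun j => ?_
    · exact h
    · exact σ.strictMono (Fin.castSucc_lt_succ)

theorem Idx.drop_zero_cons {p : ℕ} (i : ι) (σ : Idx p ι) (h : i < σ 0) :
    (Idx.cons i σ h).drop 0 = σ := by
  ext j
  rfl

theorem Idx.lt_drop {p : ℕ} {i : ι} {σ : Idx (p + 1) ι} (h : i < σ 0) (k : Fin (p + 2)) :
    i < σ.drop k 0 :=
  h.trans_le (σ.monotone (Fin.zero_le _))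

theorem Idx.drop_succ_cons {p : ℕ} (i : ι) (σ : Idx (p + 1) ι) (h : i < σ 0) (k : Fin (p + 2)) :
    (Idx.cons i σ h).drop k.succ = Idx.cons i (σ.drop k) (Idx.lt_drop h k) := by
  ext j
  exact congrFun (cons_comp_succAbove_succ i σ k) j

theorem Idx.cons_drop_zero {p : ℕ} (σ : Idx (p + 1) ι) (h : σ 0 < σ.drop 0 0) :
    Idx.cons (σ 0) (σ.drop 0) h = σ := by
  ext j
  exact Fin.cases rfl (fun _ => rfl) j

/-- The index `i` as an oriented `0`-simplex. -/
def Idx.single (i : ι) : Idx 0 ι :=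
  OrderEmbedding.ofStrictMono (fun _ => i) (fun i j h => absurd h (by omega))

theorem Idx.eq_single (σ : Idx 0 ι) : σ = Idx.single (σ 0) := by
  ext j
  exact congrArg σ (Fin.ext (by omega))

/-- A singular simplex of an open set as a singular simplex of the whole space. -/
def toSpace {q : ℕ} {V : Opens X} (s : SingularSimplex q V) : SingularSimplex q X :=
  ContinuousMap.comp ⟨Subtype.val, continuous_subtype_val⟩ s

/-- A singular simplex with image in an open set as a singular simplex of this set. -/
def ofSpace {q : ℕ} {V : Opens X} (s : SingularSimplex q X) (h : ∀ x, s x ∈ V) :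
    SingularSimplex q V := ⟨fun x => ⟨s x, h x⟩, s.continuous.subtype_mk h⟩

variable {G : Type*} [AddCommGroup G] {U : ι → Opens X}

open Classical in
/-- The extension by zero of a component of a cochain of the bicomplex. -/
def extendZero {p q : ℕ} (c : E G U p q) (σ : Idx p ι) (s : SingularSimplex q X) : G :=
  if h : ∀ x, s x ∈ inter U σ then c σ (ofSpace s h) else 0

/-- Evaluating on simplices of `X` removes the dependence of the type on `σ`, so equal indices can
be rewritten freely. -/
theorem extendZero_toSpace {p q : ℕ} (c : E G U p q) (σ : Idx p ι)
    (s : SingularSimplex q (inter U σ)) : extendZero c σ (toSpace s) = c σ s :=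
  dif_pos fun x => (s x).2

theorem hor_apply {p q : ℕ} (c : E G U p q) (σ : Idx (p + 1) ι)
    (s : SingularSimplex q (inter U σ)) :
    hor G U p q c σ s =
      ∑ k : Fin (p + 2), (-1 : ℤ) ^ (k : ℕ) • extendZero c (σ.drop k) (toSpace s) := by
  change (∑ k : Fin (p + 2), (-1 : ℤ) ^ (k : ℕ) •
      resSing G q _ _ (inter_le_drop U σ k) (c (σ.drop k))) s = _
  rw [Finset.sum_apply]
  refine Finset.sum_congr rfl fun k _ => ?_
  exact congrArg _ (extendZero_toSpace c (σ.drop k)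
    (ContinuousMap.comp (incl (inter_le_drop U σ k)) s)).symm

theorem hor_ver {p q : ℕ} (c : E G U p q) :
    hor G U p (q + 1) (ver G U p q c) = ver G U (p + 1) q (hor G U p q c) := by
  funext σ s
  have h : hor G U p (q + 1) (ver G U p q c) σ s = ∑ k : Fin (p + 2), (-1 : ℤ) ^ (k : ℕ) •
      ∑ i : Fin (q + 2), (-1 : ℤ) ^ (i : ℕ) •
        extendZero c (σ.drop k) (toSpace (face i s)) := by
    rw [hor_apply]
    refine Finset.sum_congr rfl fun k _ => ?_
    congr 1
    refine (extendZero_toSpace (ver G U p q c) (σ.drop k)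
      (ContinuousMap.comp (incl (inter_le_drop U σ k)) s)).trans ?_
    change ∑ i : Fin (q + 2), (-1 : ℤ) ^ (i : ℕ) • c (σ.drop k)
      (ContinuousMap.comp (incl (inter_le_drop U σ k)) (face i s)) = _
    refine Finset.sum_congr rfl fun i _ => congrArg (fun g : G => (-1 : ℤ) ^ (i : ℕ) • g) ?_
    exact (extendZero_toSpace c (σ.drop k)
      (ContinuousMap.comp (incl (inter_le_drop U σ k)) (face i s))).symm
  rw [h]
  change _ = ∑ i : Fin (q + 2), (-1 : ℤ) ^ (i : ℕ) • hor G U p q c σ (face i s)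
  simp only [hor_apply, Finset.smul_sum]
  rw [Finset.sum_comm]
  exact Finset.sum_congr rfl fun i _ => Finset.sum_congr rfl fun k _ => smul_comm _ _ _

theorem toSpace_mem_smallSimplices {p q : ℕ} {σ : Idx p ι} (s : SingularSimplex q (inter U σ)) :
    toSpace s ∈ smallSimplices U q :=
  ⟨σ 0, fun x => mem_inter.1 (s x).2 0⟩

theorem coaugSing_eq_zero_iff {q : ℕ} {c : SingularCochain q X G} :
    coaugSing G U q c = 0 ↔ ∀ s ∈ smallSimplices U q, c s = 0 := by
  constructor
  · rintro h s ⟨i, hi⟩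
    exact congrFun (congrFun h (Idx.single i)) (ofSpace s fun x => mem_inter.2 fun _ => hi x)
  · intro h
    funext σ s
    exact h _ (toSpace_mem_smallSimplices s)

/-! ### Contraction of the rows by the smallest admissible index -/

variable [WellFoundedLT ι]

/-- The smallest index of a member of the cover which contains the image of `s`. -/
def minIdx {q : ℕ} {s : SingularSimplex q X} (h : s ∈ smallSimplices U q) : ι :=
  WellFounded.min (wellFounded_lt (α := ι)) {i | ∀ x, s x ∈ U i} h

theorem minIdx_spec {q : ℕ} {s : SingularSimplex q X} (h : s ∈ smallSimplices U q) :
    ∀ x, s x ∈ U (minIdx h) :=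
  WellFounded.min_mem (wellFounded_lt (α := ι)) {i | ∀ x, s x ∈ U i} h

theorem minIdx_le {q : ℕ} {s : SingularSimplex q X} (h : s ∈ smallSimplices U q) {i : ι}
    (hi : ∀ x, s x ∈ U i) : minIdx h ≤ i :=
  not_lt.1 (WellFounded.not_lt_min (wellFounded_lt (α := ι)) {i | ∀ x, s x ∈ U i} hi)

theorem minIdx_toSpace_le {p q : ℕ} {σ : Idx p ι} (s : SingularSimplex q (inter U σ)) :
    minIdx (toSpace_mem_smallSimplices s) ≤ σ 0 :=
  minIdx_le _ fun x => mem_inter.1 (s x).2 0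

theorem mem_inter_cons {p q : ℕ} {σ : Idx p ι} (s : SingularSimplex q (inter U σ))
    (h : minIdx (toSpace_mem_smallSimplices s) < σ 0) (x) :
    toSpace s x ∈ inter U (Idx.cons (minIdx (toSpace_mem_smallSimplices s)) σ h) :=
  mem_inter.2 (Fin.cases (minIdx_spec (toSpace_mem_smallSimplices s) x)
    fun j => mem_inter.1 (s x).2 j)

/-- The alternating sum of a cocycle at a simplex after prepending the smallest index. -/
theorem extendZero_eq_sum_of_hor_eq_zero {p q : ℕ} {c : E G U (p + 1) q}
    (hc : hor G U (p + 1) q c = 0) {σ : Idx (p + 1) ι} (s : SingularSimplex q (inter U σ))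
    (h : minIdx (toSpace_mem_smallSimplices s) < σ 0) :
    c σ s = ∑ k : Fin (p + 2), (-1 : ℤ) ^ (k : ℕ) • extendZero c
      (Idx.cons (minIdx (toSpace_mem_smallSimplices s)) (σ.drop k) (Idx.lt_drop h k))
        (toSpace s) := by
  have h0 := congrFun (congrFun hc
    (Idx.cons (minIdx (toSpace_mem_smallSimplices s)) σ h)) (ofSpace _ (mem_inter_cons s h))
  rw [hor_apply, Fin.sum_univ_succ] at h0
  simp only [Idx.drop_zero_cons, Idx.drop_succ_cons, Fin.val_succ, pow_succ, mul_neg_one,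
    neg_smul, Finset.sum_neg_distrib] at h0
  have h1 : toSpace (ofSpace (toSpace s) (mem_inter_cons s h)) = toSpace s := rfl
  rw [h1] at h0
  rw [← extendZero_toSpace c σ s]
  simpa [add_neg_eq_zero] using h0

/-- The primitive evaluates $c$ after prepending the smallest index $i$ with $s\subseteq U_i$, and
is zero when $i$ is already the first index. -/
theorem exists_hor_eq {p q : ℕ} {c : E G U (p + 1) q} (hc : hor G U (p + 1) q c = 0) :
    ∃ y : E G U p q, hor G U p q y = c := by
  classical
  let y : E G U p q := fun σ s =>
    if h : minIdx (toSpace_mem_smallSimplices s) < σ 0 then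
      extendZero c (Idx.cons (minIdx (toSpace_mem_smallSimplices s)) σ h) (toSpace s) else 0
  have hy : ∀ (σ : Idx (p + 1) ι) (s : SingularSimplex q (inter U σ)) (k : Fin (p + 2)),
      extendZero y (σ.drop k) (toSpace s) =
        if h : minIdx (toSpace_mem_smallSimplices s) < σ.drop k 0 then
          extendZero c (Idx.cons (minIdx (toSpace_mem_smallSimplices s)) (σ.drop k) h) (toSpace s)
        else 0 := fun σ s k =>
    extendZero_toSpace y (σ.drop k) (ContinuousMap.comp (incl (inter_le_drop U σ k)) s)
  refine ⟨y, ?_⟩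
  funext σ s
  rw [hor_apply]
  simp only [hy]
  -- If the smallest index is not in $\sigma$, the claim is the cocycle identity on the enlarged
  -- index. If it is $\sigma_0$, only deleting $\sigma_0$ leaves an index to which it can be
  -- prepended.
  rcases (minIdx_toSpace_le s).lt_or_eq with h | h
  · rw [extendZero_eq_sum_of_hor_eq_zero hc s h]
    exact Finset.sum_congr rfl fun k _ => by rw [dif_pos (Idx.lt_drop h k)]
  · have h0 : σ 0 < σ.drop 0 0 := σ.strictMono (Fin.succ_pos 0)
    rw [Fin.sum_univ_succ, Finset.sum_eq_zero, add_zero]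
    · simp only [h, h0, dite_true, Idx.cons_drop_zero]
      simp [extendZero_toSpace]
    · intro k _
      have hk : σ.drop k.succ 0 = σ 0 := congrArg σ (Fin.succ_succAbove_zero k)
      rw [dif_neg (by rw [h, hk]; exact lt_irrefl _), smul_zero]

theorem exists_coaugSing_eq {q : ℕ} {x : E G U 0 q} (hx : hor G U 0 q x = 0) :
    ∃ b : SingularCochain q X G, coaugSing G U q b = x := by
  classical
  -- Components agree on overlaps, so any admissible index would do; the value off small simplices
  -- is arbitrary.
  refine ⟨fun s => if h : s ∈ smallSimplices U q then extendZero x (Idx.single (minIdx h)) s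
    else 0, ?_⟩
  funext σ s
  have hs := toSpace_mem_smallSimplices s
  refine (dif_pos hs).trans ?_
  change extendZero x _ (toSpace s) = _
  rcases (minIdx_toSpace_le s).lt_or_eq with h | h
  · have h0 := congrFun (congrFun hx (Idx.cons _ σ h)) (ofSpace _ (mem_inter_cons s h))
    rw [hor_apply, Fin.sum_univ_two, Idx.drop_zero_cons,
      Idx.eq_single ((Idx.cons _ σ h).drop 1)] at h0
    change _ • extendZero x σ (toSpace s) + _ • extendZero x (Idx.single (minIdx hs)) (toSpace s)
      = 0 at h0
    rw [← extendZero_toSpace x σ s]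
    simp only [Fin.val_zero, pow_zero, one_smul, Fin.val_one, pow_one, neg_smul,
      add_neg_eq_zero] at h0
    exact h0.symm
  · have e : Idx.single (minIdx hs) = σ := (congrArg Idx.single h).trans (Idx.eq_single σ).symm
    exact (congrArg (extendZero x · (toSpace s)) e).trans (extendZero_toSpace x σ s)

end Rows

/-! ### The comparison of singular and total cohomology -/

section Comparison

variable {X : Type*} [TopologicalSpace X] {ι : Type*} {G : Type*} [AddCommGroup G]
  {U : ι → Opens X}

theorem eval_single {n : ℕ} (c : SingularCochain n X G) (s : SingularSimplex n X) :
    eval c (Finsupp.single s 1) = c s := by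
  simp [eval]

theorem eval_eq_zero {n : ℕ} {c : SingularCochain n X G}
    (hc : ∀ s ∈ smallSimplices U n, c s = 0) {z : SingularChain n X}
    (hz : z ∈ chainsOn (smallSimplices U n)) : eval c z = 0 := by
  refine AddSubgroup.mem_bot.1 (map_mem_of_mem_chainsOn (eval c) ⊥ (fun s hs => ?_) hz)
  rw [AddSubgroup.mem_bot, eval_single, hc s hs]

theorem boundary_mem_smallSimplices {n : ℕ} {s : SingularSimplex (n + 1) X}
    (hs : s ∈ smallSimplices U (n + 1)) :
    boundary n X (Finsupp.single s 1) ∈ chainsOn (smallSimplices U n) := by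
  rw [boundary_single]
  exact sum_mem fun i _ => zsmul_mem (single_mem_chainsOn (face_mem_smallSimplices hs i)) _

theorem eval_ofHom {n : ℕ} (f : SingularChain n X →+ G) (z : SingularChain n X) :
    eval (fun s => f (Finsupp.single s 1)) z = f z := by
  have : eval (fun s => f (Finsupp.single s 1)) = f := chainHom_ext fun s => eval_single _ s
  rw [this]

theorem coboundary_coboundary {n : ℕ} (c : SingularCochain n X G) :
    coboundary (n + 1) X G (coboundary n X G c) = 0 := by
  funext s
  rw [← eval_single (coboundary (n + 1) X G _), eval_coboundary, eval_coboundary,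
    boundary_boundary, map_zero]
  rfl

/-- Evaluating $c$ on the small chain $s-\partial hs-h\partial s$ gives $0=c(s)-c(h\partial s)$, so
$c\circ h$ is a primitive. -/
theorem exists_coboundary_eq_of_small (hU : ∀ x, ∃ i, x ∈ U i) {n : ℕ}
    {c : SingularCochain (n + 1) X G} (hc : coboundary (n + 1) X G c = 0)
    (hsmall : ∀ s ∈ smallSimplices U (n + 1), c s = 0) :
    ∃ b : SingularCochain n X G, coboundary n X G b = c := by
  refine ⟨fun s => (eval c).comp (smallHomotopy hU n) (Finsupp.single s 1), ?_⟩
  funext s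
  have h := eval_eq_zero hsmall (sub_smallHomotopy_mem hU (Finsupp.single s 1))
  rw [← eval_single (coboundary n X G _), eval_coboundary, eval_ofHom, AddMonoidHom.comp_apply]
  rw [map_sub, map_sub, ← eval_coboundary, hc, map_zero, AddMonoidHom.zero_apply, sub_zero,
    eval_single, sub_eq_zero] at h
  exact h.symm

/-- Take $c\circ\rho$ with $\rho=1-\partial h-h\partial$. Since $\partial\rho=\rho\partial$, its
coboundary evaluates $dc$ on small chains; and $\rho$ fixes small simplices because $h$ vanishes on
them and on their boundaries. -/
theorem exists_cocycle_of_small (hU : ∀ x, ∃ i, x ∈ U i) {n : ℕ}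
    {c : SingularCochain (n + 1) X G}
    (hc : ∀ s ∈ smallSimplices U (n + 2), coboundary (n + 1) X G c s = 0) :
    ∃ c' : SingularCochain (n + 1) X G, coboundary (n + 1) X G c' = 0 ∧
      ∀ s ∈ smallSimplices U (n + 1), c' s = c s := by
  let ρ : SingularChain (n + 1) X →+ SingularChain (n + 1) X := AddMonoidHom.id _ -
    (boundary (n + 1) X).comp (smallHomotopy hU (n + 1)) -
    (smallHomotopy hU n).comp (boundary n X)
  have hρ : ∀ z, ρ z = z - boundary (n + 1) X (smallHomotopy hU (n + 1) z) -
    smallHomotopy hU n (boundary n X z) := fun z => rfl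
  refine ⟨fun s => (eval c).comp ρ (Finsupp.single s 1), ?_, fun s hs => ?_⟩
  · funext s
    have h := eval_eq_zero hc (sub_smallHomotopy_mem hU (Finsupp.single s 1))
    rw [← eval_single (coboundary (n + 1) X G _), eval_coboundary, eval_ofHom,
      AddMonoidHom.comp_apply, hρ, boundary_boundary, map_zero, sub_zero]
    rw [eval_coboundary] at h
    simp only [map_sub, boundary_boundary, sub_zero] at h ⊢
    exact h
  · change eval c (ρ (Finsupp.single s 1)) = _
    rw [hρ, smallHomotopy_eq_zero hU (single_mem_chainsOn hs),
      smallHomotopy_eq_zero hU (boundary_mem_smallSimplices hs), map_zero, sub_zero, sub_zero,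
      eval_single]

variable [LinearOrder ι]

theorem ver_ver {p q : ℕ} (c : E G U p q) : ver G U p (q + 1) (ver G U p q c) = 0 := by
  funext σ
  exact coboundary_coboundary (c σ)

variable [WellFoundedLT ι]

theorem coaugSingCoh₂_injective (hU : ∀ x, ∃ i, x ∈ U i) :
    Function.Injective (coaugSingCoh₂ G U : SingularCoh₂ X G → TotCoh₂ G U) := by
  rw [injective_iff_map_eq_zero]
  intro a
  obtain ⟨⟨c, hc⟩, rfl⟩ := QuotientAddGroup.mk_surjective a
  intro h
  obtain ⟨⟨x, y⟩, hxy⟩ := (QuotientAddGroup.eq_zero_iff _).1 h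
  have hxy' : D₁ G U (x, y) = (coaugSing G U 2 c, 0, 0) := hxy
  rw [D₁_apply, Prod.mk.injEq, Prod.mk.injEq] at hxy'
  obtain ⟨h1, h2, h3⟩ := hxy'
  -- Subtracting $Dz$ removes the component in $E^{1,0}$. What remains, $x-dz$, is $\delta$-closed
  -- and glues to a cochain $b$, so that $c-db$ vanishes on small simplices.
  obtain ⟨z, rfl⟩ := exists_hor_eq h3
  have h4 : hor G U 0 1 (x - ver G U 0 0 z) = 0 := by
    rw [map_sub, hor_ver]
    exact h2
  obtain ⟨b, hb⟩ := exists_coaugSing_eq h4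
  have h5 : coaugSing G U 2 (c - coboundary 1 X G b) = 0 := by
    rw [map_sub, ← ver_coaugSing, hb, map_sub, ver_ver, sub_zero, h1, sub_self]
  have h6 : coboundary 2 X G (c - coboundary 1 X G b) = 0 := by
    rw [map_sub, coboundary_coboundary, sub_zero]
    exact hc
  obtain ⟨b', hb'⟩ := exists_coboundary_eq_of_small hU h6 (coaugSing_eq_zero_iff.1 h5)
  refine (QuotientAddGroup.eq_zero_iff _).2 ⟨b + b', ?_⟩
  rw [map_add, hb']
  exact add_sub_cancel _ _

theorem exists_coaugSingCoh₂_eq (hU : ∀ x, ∃ i, x ∈ U i) (a : CechCoh₂ G U) :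
    ∃ c : SingularCoh₂ X G, coaugSingCoh₂ G U c = coaugCechCoh₂ G U a := by
  obtain ⟨⟨φ, hφ⟩, rfl⟩ := QuotientAddGroup.mk_surjective a
  have h1 : hor G U 2 0 (coaugCech G U 2 φ) = 0 := by
    rw [hor_coaugCech, show cechDiffG G U 2 φ = 0 from hφ, map_zero]
  obtain ⟨y, hy⟩ := exists_hor_eq h1
  have h2 : hor G U 1 1 (ver G U 1 0 y) = 0 := by
    rw [hor_ver, hy, ver_coaugCech]
  obtain ⟨x, hx⟩ := exists_hor_eq h2
  have h3 : hor G U 0 2 (ver G U 0 1 x) = 0 := by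
    rw [hor_ver, hx, ver_ver]
  obtain ⟨c, hc⟩ := exists_coaugSing_eq h3
  have h4 : coaugSing G U 3 (coboundary 2 X G c) = 0 := by
    rw [← ver_coaugSing, hc, ver_ver]
  -- The glued cochain is closed only on small simplices; it is corrected without changing its
  -- restriction.
  obtain ⟨c', hc', hcc'⟩ := exists_cocycle_of_small hU (coaugSing_eq_zero_iff.1 h4)
  have h5 : coaugSing G U 2 c' = ver G U 0 1 x := by
    rw [← hc, ← sub_eq_zero, ← map_sub, coaugSing_eq_zero_iff]
    exact fun s hs => sub_eq_zero.2 (hcc' s hs)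
  -- Here $D(x,y)=rc'+h\varphi$, hence the minus sign.
  refine ⟨-HomologyOf.mk _ _ ⟨c', hc'⟩, ?_⟩
  rw [map_neg, neg_eq_iff_add_eq_zero]
  refine (QuotientAddGroup.eq_zero_iff _).2 ⟨(x, y), ?_⟩
  change D₁ G U (x, y) = (coaugSing G U 2 c', 0, 0) + (0, 0, coaugCech G U 2 φ)
  rw [D₁_apply, hx, hy, h5, sub_self]
  simp

end Comparison

/-! ### Evaluation on the fundamental class -/

section Evaluation

variable {X : Type*} [TopologicalSpace X] {ι : Type*} [LinearOrder ι] {G : Type*} [AddCommGroup G]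
  {U : ι → Opens X}

theorem mem_inter_single {i : ι} {x : X} (hx : x ∈ U i) : x ∈ inter U (Idx.single i) :=
  mem_inter.2 fun _ => hx

/-- The increasing pair `(i, j)` as an oriented `1`-simplex. -/
def Idx.pair (i j : ι) (h : i < j) : Idx 1 ι := Idx.cons i (Idx.single j) h

theorem mem_inter_pair {i j : ι} (h : i < j) {x : X} (hi : x ∈ U i) (hj : x ∈ U j) :
    x ∈ inter U (Idx.pair i j h) :=
  mem_inter.2 (Fin.cases hi fun _ => hj)

theorem apply_of_coaugSing_eq_ver {c : SingularCochain 2 X G} {x : E G U 0 1}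
    (h : coaugSing G U 2 c = ver G U 0 1 x) {i : ι} {s : SingularSimplex 2 X}
    (hs : ∀ t, s t ∈ U i) :
    c s = extendZero x (Idx.single i) (face (0 : Fin 3) s) -
      extendZero x (Idx.single i) (face (1 : Fin 3) s) +
      extendZero x (Idx.single i) (face (2 : Fin 3) s) := by
  set s' := ofSpace s fun t => mem_inter_single (hs t)
  have h1 : c s = ∑ j : Fin 3, (-1 : ℤ) ^ (j : ℕ) • x (Idx.single i) (face j s') :=
    congrFun (congrFun h (Idx.single i)) s'
  have h2 : ∀ j : Fin 3, x (Idx.single i) (face j s') =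
      extendZero x (Idx.single i) (face j s) := fun j => (extendZero_toSpace x _ _).symm
  rw [h1, Fin.sum_univ_three, h2, h2, h2]
  simp [sub_eq_add_neg]

theorem sub_of_hor_eq_ver {x : E G U 0 1} {y : E G U 1 0}
    (h : hor G U 0 1 x = ver G U 1 0 y) {i j : ι} (hij : i < j) {s : SingularSimplex 1 X}
    (hi : ∀ t, s t ∈ U i) (hj : ∀ t, s t ∈ U j) :
    extendZero x (Idx.single j) s - extendZero x (Idx.single i) s =
      extendZero y (Idx.pair i j hij) (face (0 : Fin 2) s) -
        extendZero y (Idx.pair i j hij) (face (1 : Fin 2) s) := by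
  set s' := ofSpace s fun t => mem_inter_pair hij (hi t) (hj t)
  have h1 : hor G U 0 1 x (Idx.pair i j hij) s' =
      ∑ a : Fin 2, (-1 : ℤ) ^ (a : ℕ) • y (Idx.pair i j hij) (face a s') :=
    congrFun (congrFun h (Idx.pair i j hij)) s'
  have h2 : ∀ a : Fin 2, y (Idx.pair i j hij) (face a s') =
      extendZero y (Idx.pair i j hij) (face a s) := fun a => (extendZero_toSpace y _ _).symm
  have h3 : (Idx.pair i j hij).drop 0 = Idx.single j := Idx.drop_zero_cons _ _ _
  have h4 : (Idx.pair i j hij).drop 1 = Idx.single i := Idx.eq_single _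
  rw [hor_apply, Fin.sum_univ_two, Fin.sum_univ_two, h2, h2, h3, h4,
    show toSpace s' = s from rfl] at h1
  simpa [sub_eq_add_neg] using h1

end Evaluation

/-! ### Faces, edges and vertices of the tetrahedron on the sphere -/

section SphereEvaluation

variable {G : Type*} [AddCommGroup G] {U : Fin 4 → Opens S2} (Φ : TetraBoundary ≃ₜ S2)

theorem sphereFace_mem (hU : ∀ i, Φ '' tetraFace i ⊆ U i) (i : Fin 4) (t) :
    sphereFace Φ i t ∈ U i :=
  hU i ⟨tetraFaceSimplex i t, map_succAbove_apply_self i t, rfl⟩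

/-- The vertex `e l` on the sphere as a singular `0`-simplex. -/
def vertexSimplex (l : Fin 4) : SingularSimplex 0 S2 := ContinuousMap.const _ (sphereVertex Φ l)

theorem face_face_sphereFace (i : Fin 4) (j : Fin 3) (k : Fin 2) (l : Fin 4)
    (h : i.succAbove (j.succAbove (k.succAbove 0)) = l) :
    face k (face j (sphereFace Φ i)) = vertexSimplex Φ l := by
  ext1 t
  refine congrArg Φ (Subtype.ext ?_)
  change stdSimplex.map i.succAbove (stdSimplex.map j.succAbove (stdSimplex.map k.succAbove t)) =
    stdSimplex.vertex l
  have ht : t = stdSimplex.vertex 0 := Subsingleton.elim _ _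
  rw [ht, stdSimplex.map_vertex, stdSimplex.map_vertex, stdSimplex.map_vertex, h]

theorem valueAt_of_hor_eq {y : E G U 1 0} {φ : CechG G U 2}
    (h : hor G U 1 0 y = -coaugCech G U 2 φ) (hU : ∀ i, Φ '' tetraFace i ⊆ U i)
    (i j k l : Fin 4) (hij : i < j) (hjk : j < k) (hl : i ≠ l ∧ j ≠ l ∧ k ≠ l) :
    valueAt Φ hU φ i j k l hij hjk hl =
      -(extendZero y (Idx.pair j k hjk) (vertexSimplex Φ l) -
        extendZero y (Idx.pair i k (hij.trans hjk)) (vertexSimplex Φ l) +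
        extendZero y (Idx.pair i j hij) (vertexSimplex Φ l)) := by
  set s := ofSpace (vertexSimplex Φ l) fun _ => sphereVertex_mem Φ hU hij hjk l hl
  have h1 : hor G U 1 0 y (triple i j k hij hjk) s = -valueAt Φ hU φ i j k l hij hjk hl :=
    congrFun (congrFun h (triple i j k hij hjk)) s
  have h2 : (triple i j k hij hjk).drop 0 = Idx.pair j k hjk := by
    ext a; fin_cases a <;> rfl
  have h3 : (triple i j k hij hjk).drop 1 = Idx.pair i k (hij.trans hjk) := by
    ext a; fin_cases a <;> rfl
  have h4 : (triple i j k hij hjk).drop 2 = Idx.pair i j hij := by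
    ext a; fin_cases a <;> rfl
  rw [hor_apply, Fin.sum_univ_three, h2, h3, h4, show toSpace s = vertexSimplex Φ l from rfl,
    ← neg_eq_iff_eq_neg] at h1
  rw [← h1]
  simp [sub_eq_add_neg]

theorem sub_of_hor_eq_ver_sphereFace {x : E G U 0 1} {y : E G U 1 0}
    (h : hor G U 0 1 x = ver G U 1 0 y) (hU : ∀ i, Φ '' tetraFace i ⊆ U i)
    (i j : Fin 4) (hij : i < j) (a b : Fin 3)
    (hab : i.succAbove ∘ a.succAbove = j.succAbove ∘ b.succAbove) (l m : Fin 4)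
    (hl : i.succAbove (a.succAbove (Fin.succAbove (0 : Fin 2) 0)) = l)
    (hm : i.succAbove (a.succAbove (Fin.succAbove (1 : Fin 2) 0)) = m) :
    extendZero x (Idx.single j) (face b (sphereFace Φ j)) =
      extendZero y (Idx.pair i j hij) (vertexSimplex Φ l) -
        extendZero y (Idx.pair i j hij) (vertexSimplex Φ m) +
        extendZero x (Idx.single i) (face a (sphereFace Φ i)) := by
  have he := face_sphereFace Φ i j a b hab
  rw [← sub_eq_iff_eq_add, ← he, ← face_face_sphereFace Φ i a 0 l hl,
    ← face_face_sphereFace Φ i a 1 m hm]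
  exact sub_of_hor_eq_ver h hij (fun t => sphereFace_mem Φ hU i _)
    fun t => he ▸ sphereFace_mem Φ hU j _

theorem eval_fundamentalChain (c : SingularCochain 2 S2 G) :
    eval c (fundamentalChain Φ) =
      c (sphereFace Φ 0) - c (sphereFace Φ 1) + c (sphereFace Φ 2) - c (sphereFace Φ 3) := by
  simp only [fundamentalChain, map_sub, map_add, eval_single]

theorem pairing_fundamentalClass_of_coaug_eq (hU : ∀ i, Φ '' tetraFace i ⊆ U i)
    {φ : CechG G U 2} (hφ : cechDiffG G U 2 φ = 0) {c : SingularCoh₂ S2 G}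
    (hc : coaugSingCoh₂ G U c = coaugCechCoh₂ G U (HomologyOf.mk _ _ ⟨φ, hφ⟩)) :
    pairing S2 G c (fundamentalClass Φ) =
      valueAt Φ hU φ 0 1 2 3 - valueAt Φ hU φ 0 1 3 2 +
        valueAt Φ hU φ 0 2 3 1 - valueAt Φ hU φ 1 2 3 0 := by
  obtain ⟨⟨c, hc'⟩, rfl⟩ := QuotientAddGroup.mk_surjective c
  obtain ⟨⟨x, y⟩, hxy⟩ := QuotientAddGroup.eq.1 hc.symm
  have hxy' : D₁ G U (x, y) =
    -(0, 0, coaugCech G U 2 φ) + (coaugSing G U 2 c, 0, 0) := hxy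
  rw [D₁_apply] at hxy'
  simp only [Prod.neg_mk, Prod.mk_add_mk, neg_zero, zero_add, add_zero, Prod.mk.injEq,
    sub_eq_zero] at hxy'
  obtain ⟨h1, h2, h3⟩ := hxy'
  refine (eval_fundamentalChain Φ c).trans ?_
  have hE := sub_of_hor_eq_ver_sphereFace Φ h2 hU
  -- Each of the six edges lies in two faces; its term $x_j$ for the larger index is replaced by
  -- $x_i$ plus endpoint values of $y_{ij}$. All remaining $x$ then cancel.
  rw [apply_of_coaugSing_eq_ver h1.symm (sphereFace_mem Φ hU 0),
    apply_of_coaugSing_eq_ver h1.symm (sphereFace_mem Φ hU 1),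
    apply_of_coaugSing_eq_ver h1.symm (sphereFace_mem Φ hU 2),
    apply_of_coaugSing_eq_ver h1.symm (sphereFace_mem Φ hU 3),
    hE 2 3 (by decide) 2 2 (by decide) 1 0 (by decide) (by decide),
    hE 1 3 (by decide) 2 1 (by decide) 2 0 (by decide) (by decide),
    hE 0 3 (by decide) 2 0 (by decide) 2 1 (by decide) (by decide),
    hE 1 2 (by decide) 1 1 (by decide) 3 0 (by decide) (by decide),
    hE 0 2 (by decide) 1 0 (by decide) 3 1 (by decide) (by decide),
    hE 0 1 (by decide) 0 0 (by decide) 3 2 (by decide) (by decide),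
    valueAt_of_hor_eq Φ h3, valueAt_of_hor_eq Φ h3, valueAt_of_hor_eq Φ h3,
    valueAt_of_hor_eq Φ h3]
  abel

end SphereEvaluation

end
end CechSingular

theorem mainTheorem7
    (Φ : CechSingular.TetraBoundary ≃ₜ CechSingular.S2)
    (U : Fin 4 → TopologicalSpace.Opens CechSingular.S2)
    (hU : ∀ i, Φ '' CechSingular.tetraFace i ⊆ U i)
    (hgood : CechSingular.IsGoodCover U)
    {G : Type*} [AddCommGroup G]
    (φ : CechSingular.CechG G U 2) (hφ : CechSingular.cechDiffG G U 2 φ = 0) :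
    (∃! c : CechSingular.SingularCoh₂ CechSingular.S2 G,
      CechSingular.coaugSingCoh₂ G U c =
        CechSingular.coaugCechCoh₂ G U (CechSingular.HomologyOf.mk _ _ ⟨φ, hφ⟩)) ∧
    CechSingular.pairing CechSingular.S2 G
        (CechSingular.cechToSingular G U (CechSingular.HomologyOf.mk _ _ ⟨φ, hφ⟩))
        (CechSingular.fundamentalClass Φ) =
      CechSingular.valueAt Φ hU φ 0 1 2 3 - CechSingular.valueAt Φ hU φ 0 1 3 2 +
        CechSingular.valueAt Φ hU φ 0 2 3 1 - CechSingular.valueAt Φ hU φ 1 2 3 0 := by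
  obtain ⟨c, hc⟩ := CechSingular.exists_coaugSingCoh₂_eq (G := G) hgood.covers
    (CechSingular.HomologyOf.mk _ _ ⟨φ, hφ⟩)
  exact ⟨⟨c, hc, fun c' hc' =>
      CechSingular.coaugSingCoh₂_injective hgood.covers (hc'.trans hc.symm)⟩,
    CechSingular.pairing_fundamentalClass_of_coaug_eq Φ hU hφ (Function.invFun_eq ⟨c, hc⟩)⟩
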